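/- For a profinite group $G$ let $d(G)$ be the minimal cardinality of a topological generating set of $G$, let $\mathrm{rk}(G)=\sup\{d(H)\mid H\le G \text{ closed}\}$, and for a prime $\ell$ let $\mathrm{rk}_\ell(G)=\mathrm{rk}(S)$, where $S$ is any Sylow pro-$\ell$ subgroup of $G$ (finite groups carry the discrete topology). **Theorem.** Let $p$ be an odd prime, let $d\ge 1$ be an integer, and let $\ell\neq p$ be a prime. Let $d_0\in\{0,1\}$ with $d\equiv d_0 \pmod 2$, and let $m(p,\ell)$ be the least integer $n\ge 1$ such that $\ell$ divides $p^n-1$. Then $$\mathrm{rk}_\ell(\mathrm{GL}_d(\mathbb{Z}_p))=\mathrm{rk}_\ell(\mathrm{GL}_d(\mathbb{F}_p))=\begin{cases}\lfloor d/m(p,\ell)\rfloor & \text{if } p\not\equiv 1 \pmod \ell,\\ (3d-d_0)/2 & \text{if } \ell=2 \text{ and } p\equiv 1 \pmod 4,\\ d & \text{in all other cases.}\end{cases}$$ -/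

import Mathlib

namespace PadicLieRank

/-- `d(G)`: the minimal cardinality of a topological generating set of the topological group `G`
(a value in `ℕ∞`). -/
noncomputable def minGenerators (G : Type*) [Group G] [TopologicalSpace G]
    [IsTopologicalGroup G] : ℕ∞ :=
  ⨅ (T : Set G) (_ : (Subgroup.closure T).topologicalClosure = ⊤), T.encard

/-- The rank `rk(G) = sup {d(H)}`, where `H` ranges over all closed subgroups of `G`. -/
noncomputable def rank (G : Type*) [Group G] [TopologicalSpace G] [IsTopologicalGroup G] : ℕ∞ :=
  ⨆ (H : Subgroup G) (_ : IsClosed (H : Set G)), minGenerators H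

/-- `G` is a pro-`ℓ` group: a profinite group (that is, compact and totally disconnected) in which
every open normal subgroup has index a power of `ℓ`. -/
def IsPro (ℓ : ℕ) (G : Type*) [Group G] [TopologicalSpace G] : Prop :=
  CompactSpace G ∧ TotallyDisconnectedSpace G ∧
    ∀ N : Subgroup G, N.Normal → IsOpen (N : Set G) → ∃ k : ℕ, N.index = ℓ ^ k

/-- `S` is a Sylow pro-`ℓ` subgroup of the profinite group `G`: a closed pro-`ℓ` subgroup whose
(supernatural) index, the least common multiple of the indices of the open subgroups that contain
`S`, is not divisible by `ℓ`. -/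
def IsSylowPro (ℓ : ℕ) {G : Type*} [Group G] [TopologicalSpace G] (S : Subgroup G) : Prop :=
  IsClosed (S : Set G) ∧ IsPro ℓ S ∧
    ∀ U : Subgroup G, IsOpen (U : Set G) → S ≤ U → ¬ ℓ ∣ U.index

/-- `rk_ℓ(G) = r`: the profinite group `G` has a Sylow pro-`ℓ` subgroup, and any Sylow pro-`ℓ`
subgroup of `G` has rank `r`. -/
def EllRankEq (ℓ : ℕ) (G : Type*) [Group G] [TopologicalSpace G] [IsTopologicalGroup G]
    (r : ℕ∞) : Prop :=
  (∃ S : Subgroup G, IsSylowPro ℓ S) ∧ ∀ S : Subgroup G, IsSylowPro ℓ S → rank S = r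

/-- `m(p, ℓ)`: the least positive integer `n` such that `ℓ` divides `p ^ n - 1`. -/
noncomputable def m (p ℓ : ℕ) : ℕ :=
  sInf {n : ℕ | 0 < n ∧ ℓ ∣ p ^ n - 1}

end PadicLieRank

/-!
The `ℓ`-rank of both groups is the largest number of generators of an `ℓ`-subgroup of
`GL_d(𝔽_p)`. For `GL_d(ℤ_p)` this is because the kernel of reduction modulo `p` is a pro-`p` group:
Sylow pro-`ℓ` subgroups map isomorphically onto Sylow subgroups of `GL_d(𝔽_p)`, and one exists by
Sylow's theorem modulo each power of `p` together with compactness (`PFiltration.ellRankEq`).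

The `ℓ`-subgroups of `GL_d(𝔽_p)` are found by counting. Comparing the order of `GL_d(𝔽_p)`, computed
by lifting the exponent (`padicValNat_card_GL_eq`), with that of a wreath product `X ≀ Sym(n)`
embedded in it shows that every `ℓ`-subgroup is isomorphic to a subgroup of the wreath product
(`exists_subgroup_mulEquiv`). Here `X` is the multiplicative group of the field `E` of `p ^ m`
elements and `n = ⌊d / m⌋`; for `ℓ = 2` and `p ≡ 3 (mod 4)` it is `Eˣ ⋊ Gal(E / 𝔽_p)` with `m = 2`,
with an extra factor `𝔽_pˣ` if `d` is odd.

An `ℓ`-subgroup `H` of `X ≀ Sym(Ω)`, with `X` cyclic, has the abelian normal subgroup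
`A = H ∩ X ^ Ω`, and `H / A` is a permutation group, generated by `⌊|Ω| / ℓ⌋` elements
(`genLE_perm`). As `A` is generated by `|Ω|` elements, this gives `⌊3 |Ω| / 2⌋` for `ℓ = 2`. For
odd `ℓ` one may assume that `H` is transitive (`genLE_wreath_of_transitive`). If `|Ω| > 1`, there
is `z ∈ H` all of whose cycles on `Ω` have length `ℓ`, and `A` needs only `2 |Ω| / ℓ` generators as
a group with an action of `z`: the norm `∏ zⁱ a z⁻ⁱ` takes values in `|Ω| / ℓ` copies of `X`, and
the kernel `B` of the norm needs at most `log_ℓ |C_B(z)| ≤ |Ω| / ℓ` generators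
(`exists_generators_of_centralizer`). The total is `3 |Ω| / ℓ ≤ |Ω|`. For `p ≡ 3 (mod 4)`, `H` is an
extension of a `2`-subgroup of `C_2 ≀ Sym(n)`, generated by `n` elements, by a subgroup of
`(Eˣ) ^ n`.

The bounds are attained by diagonal matrices of order `ℓ`, and, for `ℓ = 2` and `p ≡ 1 (mod 4)`, by
block diagonal matrices with blocks in a group of order `16` in `GL_2(𝔽_p)` that needs three
generators (`pauliGroup`).
-/

namespace PadicLieRank

/-! ### Numbers of generators of abstract groups -/

/-- The group `G` can be generated by at most `n` elements. -/
def GenLE (n : ℕ) (G : Type*) [Group G] : Prop :=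
  ∃ T : Finset G, T.card ≤ n ∧ Subgroup.closure (T : Set G) = ⊤

section Generators

variable {G Q : Type*} [Group G] [Group Q]

theorem GenLE.mono {m n : ℕ} (h : GenLE m G) (hmn : m ≤ n) : GenLE n G :=
  let ⟨T, hT, hc⟩ := h
  ⟨T, hT.trans hmn, hc⟩

theorem GenLE.of_surjective {n : ℕ} (h : GenLE n G) (f : G →* Q) (hf : Function.Surjective f) :
    GenLE n Q := by
  classical
  obtain ⟨T, hT, hc⟩ := h
  refine ⟨T.image f, Finset.card_image_le.trans hT, ?_⟩
  rw [Finset.coe_image, ← MonoidHom.map_closure, hc, ← MonoidHom.range_eq_map,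
    MonoidHom.range_eq_top.mpr hf]

theorem GenLE.of_mulEquiv {n : ℕ} (h : GenLE n G) (e : G ≃* Q) : GenLE n Q :=
  h.of_surjective e.toMonoidHom e.surjective

theorem GenLE.of_subsingleton [Subsingleton G] (n : ℕ) : GenLE n G :=
  ⟨∅, by simp, Subsingleton.elim _ _⟩

/-- Lifts of generators of the image of `f` generate `G` modulo the kernel of `f`. -/
theorem GenLE.exists_closure_sup_ker {n : ℕ} (f : G →* Q) (h : GenLE n f.range) :
    ∃ T : Finset G, T.card ≤ n ∧ Subgroup.closure (T : Set G) ⊔ f.ker = ⊤ := by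
  classical
  obtain ⟨T, hT, hc⟩ := h
  choose g hg using f.rangeRestrict_surjective
  refine ⟨T.image g, Finset.card_image_le.trans hT, ?_⟩
  rw [← MonoidHom.ker_rangeRestrict, ← Subgroup.comap_map_eq, MonoidHom.map_closure,
    Finset.coe_image, Set.image_image]
  simp [hg, hc]

theorem GenLE.of_range_of_ker {a b : ℕ} (f : G →* Q) (ha : GenLE a f.range)
    (hb : GenLE b f.ker) : GenLE (a + b) G := by
  classical
  obtain ⟨S, hS, hSc⟩ := ha.exists_closure_sup_ker f
  obtain ⟨T, hT, hTc⟩ := hb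
  refine ⟨S ∪ T.image f.ker.subtype, (Finset.card_union_le _ _).trans
    (add_le_add hS (Finset.card_image_le.trans hT)), ?_⟩
  rw [Finset.coe_union, Subgroup.closure_union, Finset.coe_image, ← MonoidHom.map_closure, hTc,
    ← MonoidHom.range_eq_map, Subgroup.range_subtype, hSc]

/-- An `ℓ`-group of order at most `ℓ ^ k` is generated by `k` elements: each new generator
multiplies the order of the generated subgroup by at least `ℓ`. -/
theorem GenLE.of_card_le {ℓ k : ℕ} [Fact ℓ.Prime] [Finite G] (hG : IsPGroup ℓ G)
    (hk : Nat.card G ≤ ℓ ^ k) : GenLE k G := by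
  classical
  have hℓ : ℓ.Prime := Fact.out
  by_contra hcon
  have key : ∀ j ≤ k + 1, ∃ T : Finset G, T.card ≤ j ∧
      ℓ ^ j ≤ Nat.card (Subgroup.closure (T : Set G)) := by
    intro j
    induction j with
    | zero => exact fun _ => ⟨∅, by simp, by simp⟩
    | succ j ih =>
      intro hj
      obtain ⟨T, hT, hc⟩ := ih (by omega)
      have hne : Subgroup.closure (T : Set G) ≠ ⊤ := fun h => hcon ⟨T, by omega, h⟩
      obtain ⟨x, hx⟩ : ∃ x, x ∉ Subgroup.closure (T : Set G) := by
        by_contra! h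
        exact hne ((Subgroup.eq_top_iff' _).mpr h)
      refine ⟨insert x T, (Finset.card_insert_le _ _).trans (by omega), ?_⟩
      set A := Subgroup.closure (T : Set G)
      set B := Subgroup.closure ((insert x T : Finset G) : Set G)
      have hAB : A ≤ B := Subgroup.closure_mono (by simp)
      have hxB : x ∈ B := Subgroup.subset_closure (by simp)
      obtain ⟨a, ha⟩ := (IsPGroup.iff_card.mp (hG.to_subgroup A))
      obtain ⟨b, hb⟩ := (IsPGroup.iff_card.mp (hG.to_subgroup B))
      have hlt : Nat.card A < Nat.card B := by
        refine lt_of_le_of_ne (Subgroup.card_le_of_le hAB) fun h => hx ?_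
        rw [Subgroup.eq_of_le_of_card_ge hAB h.ge]
        exact hxB
      rw [ha] at hc hlt
      rw [hb] at hlt ⊢
      have h1 := (Nat.pow_lt_pow_iff_right hℓ.one_lt).mp hlt
      have h2 := (Nat.pow_le_pow_iff_right hℓ.one_lt).mp hc
      exact Nat.pow_le_pow_right hℓ.pos (by omega)
  obtain ⟨T, -, hT⟩ := key (k + 1) le_rfl
  have h1 := hT.trans ((Subgroup.card_le_card_group _).trans hk)
  have h2 := (Nat.pow_le_pow_iff_right hℓ.one_lt).mp h1
  omega

theorem GenLE.of_isCyclic [IsCyclic G] : GenLE 1 G := by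
  obtain ⟨g, hg⟩ := IsCyclic.exists_generator (α := G)
  refine ⟨{g}, by simp, ?_⟩
  rw [Finset.coe_singleton, ← Subgroup.zpowers_eq_closure]
  exact (Subgroup.eq_top_iff' _).mpr hg

/-- A group with a separating family of `n` homomorphisms to a cyclic group is generated by `n`
elements. -/
theorem GenLE.of_separating_fin {X : Type*} [Group X] [IsCyclic X] (n : ℕ) :
    ∀ {A : Type*} [Group A] (χ : Fin n → A →* X), (∀ a, (∀ i, χ i a = 1) → a = 1) →
      GenLE n A := by
  induction n with
  | zero =>
    intro A _ χ h
    have : Subsingleton A := ⟨fun a b => by rw [h a (fun i => i.elim0), h b (fun i => i.elim0)]⟩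
    exact GenLE.of_subsingleton 0
  | succ n ih =>
    intro A _ χ h
    have h1 : GenLE 1 (χ 0).range := GenLE.of_isCyclic
    have h2 : GenLE n (χ 0).ker :=
      ih (fun i => (χ i.succ).comp (χ 0).ker.subtype) fun a ha => by
        refine Subtype.ext (h a fun i => ?_)
        refine Fin.cases a.2 (fun i => ha i) i
    rw [add_comm]
    exact h1.of_range_of_ker _ h2

theorem GenLE.of_separating {X ι : Type*} [Group X] [IsCyclic X] [Finite ι]
    (χ : ι → G →* X) (h : ∀ a, (∀ i, χ i a = 1) → a = 1) : GenLE (Nat.card ι) G :=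
  GenLE.of_separating_fin (Nat.card ι) (fun i => χ ((Finite.equivFin ι).symm i)) fun a ha =>
    h a fun i => by simpa using ha (Finite.equivFin ι i)

/-- Let `z` normalize the abelian subgroup `B` of the `ℓ`-group `G`. The subgroup `[B, z]` of `B`
has index `|C_B(z)|`, and, since commutation with `z` is nilpotent on `B`, a `z`-invariant subgroup
that covers `B / [B, z]` is all of `B`. -/
theorem exists_generators_of_centralizer {ℓ k : ℕ} [Fact ℓ.Prime] [Finite G] (hG : IsPGroup ℓ G)
    (B : Subgroup G) (hB : ∀ a ∈ B, ∀ b ∈ B, a * b = b * a) (z : G)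
    (hz : ∀ b ∈ B, z * b * z⁻¹ ∈ B)
    (hk : Nat.card {b : B // z * b * z⁻¹ = b} ≤ ℓ ^ k) :
    ∃ T : Finset G, T.card ≤ k ∧ ∀ R : Subgroup G, (T : Set G) ⊆ R →
      (∀ b ∈ B, b ∈ R → z * b * z⁻¹ ∈ R) → B ≤ R := by
  classical
  let δ : B →* B :=
    { toFun := fun b => ⟨z * b * z⁻¹ * (b : G)⁻¹, B.mul_mem (hz b b.2) (B.inv_mem b.2)⟩
      map_one' := by ext; simp
      map_mul' := fun a b => by
        ext
        have h := hB _ (B.mul_mem (hz b b.2) (B.inv_mem b.2)) _ (B.inv_mem a.2)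
        simp only [Subgroup.coe_mul, mul_inv_rev]
        calc z * (a * b) * z⁻¹ * ((b : G)⁻¹ * (a : G)⁻¹)
            = z * a * z⁻¹ * ((z * b * z⁻¹ * (b : G)⁻¹) * (a : G)⁻¹) := by group
          _ = _ := by rw [h]; group }
  have hδ : ∀ b : B, ((δ b : B) : G) = z * b * z⁻¹ * (b : G)⁻¹ := fun b => rfl
  have hnorm : ∀ N : Subgroup B, N.Normal := fun N => ⟨fun n hn g => by
    have : g * n * g⁻¹ = n := by
      ext
      simp only [Subgroup.coe_mul, Subgroup.coe_inv]
      rw [hB g g.2 n n.2]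
      group
    rwa [this]⟩
  have := hnorm δ.range
  have hcard : Nat.card (B ⧸ δ.range) ≤ ℓ ^ k := by
    have h1 : Nat.card δ.ker ≤ ℓ ^ k := by
      refine le_trans (le_of_eq (Nat.card_congr (Equiv.subtypeEquivRight fun b => ?_))) hk
      rw [MonoidHom.mem_ker, ← Subtype.coe_inj, hδ, Subgroup.coe_one, mul_inv_eq_one]
    have h2 : Nat.card (B ⧸ δ.range) * Nat.card δ.range = Nat.card B :=
      (Subgroup.card_eq_card_quotient_mul_card_subgroup _).symm
    have h3 : Nat.card δ.ker * Nat.card δ.range = Nat.card B := by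
      rw [← Subgroup.index_ker, mul_comm, Subgroup.index_mul_card]
    have h4 : 0 < Nat.card δ.range := Nat.card_pos
    rw [Nat.eq_of_mul_eq_mul_right h4 (h2.trans h3.symm)]
    exact h1
  have hgen : GenLE k (B ⧸ δ.range) :=
    GenLE.of_card_le ((hG.to_subgroup B).to_quotient _) hcard
  obtain ⟨T, hT, hTc⟩ := GenLE.exists_closure_sup_ker (QuotientGroup.mk' δ.range)
    (hgen.of_mulEquiv (Subgroup.topEquiv.symm.trans (MulEquiv.subgroupCongr
      (MonoidHom.range_eq_top.mpr (QuotientGroup.mk'_surjective _)).symm)))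
  rw [QuotientGroup.ker_mk'] at hTc
  refine ⟨T.image B.subtype, Finset.card_image_le.trans hT, fun R hTR hR => ?_⟩
  have hcl : Subgroup.closure (T : Set B) ≤ R.subgroupOf B := by
    rw [Subgroup.closure_le]
    intro t ht
    exact hTR (Finset.mem_coe.mpr (Finset.mem_image_of_mem B.subtype ht))
  have hstab : ∀ b : B, b ∈ R.subgroupOf B → δ b ∈ R.subgroupOf B := fun b hb =>
    Subgroup.mem_subgroupOf.mpr (R.mul_mem (hR b b.2 hb) (R.inv_mem hb))
  -- `B = R · [B, z, …, z]` for any number of commutations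
  have hiter : ∀ (n : ℕ) (b : B), ∃ r ∈ R.subgroupOf B, ∃ c : B, b = r * (δ^[n]) c := by
    intro n
    induction n with
    | zero => exact fun b => ⟨1, one_mem _, b, by simp⟩
    | succ n ih =>
      intro b
      obtain ⟨r, hr, c, rfl⟩ := ih b
      have hc : c ∈ Subgroup.closure (T : Set B) ⊔ δ.range := hTc ▸ Subgroup.mem_top c
      obtain ⟨s, hs, _, ⟨e, rfl⟩, rfl⟩ := Subgroup.mem_sup_of_normal_right.mp hc
      refine ⟨r * (δ^[n]) s, mul_mem hr ?_, e, ?_⟩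
      · have : ∀ j, (δ^[j]) s ∈ R.subgroupOf B := fun j => by
          induction j with
          | zero => exact hcl hs
          | succ j ihj => rw [Function.iterate_succ_apply']; exact hstab _ ihj
        exact this n
      · rw [iterate_map_mul, Function.iterate_succ_apply, mul_assoc]
  have hlcs : ∀ (n : ℕ) (b : B),
      (((δ^[n]) b : B) : G) ∈ (⊤ : Subgroup G).lowerCentralSeries n := by
    intro n b
    induction n with
    | zero => simp
    | succ n ih =>
      rw [Function.iterate_succ_apply', hδ, Subgroup.lowerCentralSeries_succ,
        Subgroup.commutator_comm]
      exact Subgroup.commutator_mem_commutator (Subgroup.mem_top z) ih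
  have := hG.isNilpotent
  obtain ⟨n, hn⟩ := Subgroup.nilpotent_iff_lowerCentralSeries.mp this
  intro b hb
  obtain ⟨r, hr, c, hc⟩ := hiter n ⟨b, hb⟩
  have h1 := hlcs n c
  rw [hn, Subgroup.mem_bot] at h1
  have h2 : b = r := by
    have := congrArg (Subtype.val) hc
    simpa [h1] using this
  rw [h2]
  exact hr

/-- Generators of the image of `f`, of the kernel of `f` modulo `B`, and of `B` as a group with an
action of `z`, together generate `G`: since the kernel is abelian, `z` acts on it in the same way as
some element of the group that these elements generate. -/
theorem GenLE.of_ker_of_centralizer {ℓ a c k : ℕ} [Fact ℓ.Prime] [Finite G] (hG : IsPGroup ℓ G)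
    (f : G →* Q) (ha : GenLE a f.range) (hcomm : ∀ x ∈ f.ker, ∀ y ∈ f.ker, x * y = y * x)
    (B : Subgroup G) (hB : B ≤ f.ker) (z : G) (hz : ∀ b ∈ B, z * b * z⁻¹ ∈ B)
    (hk : Nat.card {b : B // z * b * z⁻¹ = b} ≤ ℓ ^ k)
    (T : Finset G) (hT : T.card ≤ c) (hTB : f.ker ≤ Subgroup.closure (T : Set G) ⊔ B) :
    GenLE (a + c + k) G := by
  classical
  obtain ⟨S, hS, hSc⟩ := ha.exists_closure_sup_ker f
  obtain ⟨U, hU, hUc⟩ := exists_generators_of_centralizer hG B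
    (fun x hx y hy => hcomm x (hB hx) y (hB hy)) z hz hk
  refine ⟨S ∪ T ∪ U, (Finset.card_union_le _ _).trans (add_le_add
    ((Finset.card_union_le _ _).trans (add_le_add hS hT)) hU), ?_⟩
  set R := Subgroup.closure ((S ∪ T ∪ U : Finset G) : Set G)
  have hSR : Subgroup.closure (S : Set G) ≤ R := Subgroup.closure_mono (by
    intro x hx; simp only [Finset.mem_coe, Finset.mem_union] at hx ⊢; tauto)
  have hTR : Subgroup.closure (T : Set G) ≤ R := Subgroup.closure_mono (by
    intro x hx; simp only [Finset.mem_coe, Finset.mem_union] at hx ⊢; tauto)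
  have hUR : (U : Set G) ⊆ R := fun x hx => Subgroup.subset_closure (by
    simp only [Finset.mem_coe, Finset.mem_union] at hx ⊢; tauto)
  have hBR : B ≤ R := by
    refine hUc R hUR fun b hb hbR => ?_
    have hzm : z ∈ Subgroup.closure (S : Set G) ⊔ f.ker := hSc ▸ Subgroup.mem_top z
    obtain ⟨r, hr, x, hx, rfl⟩ := Subgroup.mem_sup_of_normal_right.mp hzm
    have : r * x * b * (r * x)⁻¹ = r * b * r⁻¹ := by
      rw [mul_assoc r x b, hcomm x hx b (hB hb)]
      group
    rw [this]
    exact R.mul_mem (R.mul_mem (hSR hr) hbR) (R.inv_mem (hSR hr))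
  rw [eq_top_iff, ← hSc]
  exact sup_le hSR (hTB.trans (sup_le hTR hBR))

end Generators

/-! ### Generators of `ℓ`-subgroups of wreath products -/

/-- The wreath product of `X` with the full symmetric group on `Ω`. -/
abbrev Wreath (X Ω : Type*) [Group X] : Type _ :=
  (Ω → X) ⋊[mulAutArrow (G := Equiv.Perm Ω)] Equiv.Perm Ω

namespace Wreath

variable {X Ω : Type*} [Group X]

theorem mul_left_apply (v w : Wreath X Ω) (ω : Ω) :
    (v * w).left ω = v.left ω * w.left (v.right⁻¹ ω) := rfl

theorem mul_right (v w : Wreath X Ω) : (v * w).right = v.right * w.right := rfl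

instance [Finite X] [Finite Ω] : Finite (Wreath X Ω) :=
  Finite.of_equiv _ SemidirectProduct.equivProd.symm

/-- The restriction of a homomorphism to a wreath product to an invariant set of points. -/
def restrict {H : Type*} [Group H] (f : H →* Wreath X Ω) (s : Set Ω)
    (hs : ∀ h ω, (f h).right ω ∈ s ↔ ω ∈ s) : H →* Wreath X s where
  toFun h := ⟨fun ω => (f h).left ω, (f h).right.subtypePerm (hs h)⟩
  map_one' := by
    ext <;> simp
  map_mul' a b := by
    ext ω
    · simp only [map_mul, mul_left_apply]
      congr 2
    · simp only [map_mul, mul_right]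
      rfl

end Wreath

theorem isPGroup_range {ℓ : ℕ} {G Q : Type*} [Group G] [Group Q] (hG : IsPGroup ℓ G)
    (f : G →* Q) : IsPGroup ℓ f.range :=
  hG.of_surjective f.rangeRestrict f.rangeRestrict_surjective

/-- To bound the number of generators of `ℓ`-subgroups of wreath products by a superadditive
function of the number of points, it is enough to treat the subgroups that are transitive on the
points. -/
theorem genLE_wreath_of_transitive {ℓ : ℕ} {X : Type*} [Group X] [Finite X] (β : ℕ → ℕ)
    (hβ : ∀ m n, β m + β n ≤ β (m + n)) (N : ℕ)
    (htrans : ∀ (Ω : Type) [Finite Ω] [Nonempty Ω], Nat.card Ω ≤ N →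
      ∀ H : Subgroup (Wreath X Ω), IsPGroup ℓ H →
        (∀ x y : Ω, ∃ h ∈ H, h.right x = y) → GenLE (β (Nat.card Ω)) H) :
    ∀ n ≤ N, ∀ (Ω : Type) [Finite Ω], Nat.card Ω = n →
      ∀ H : Subgroup (Wreath X Ω), IsPGroup ℓ H → GenLE (β n) H := by
  classical
  intro n
  induction n using Nat.strong_induction_on with
  | _ n ih =>
  intro hn Ω _ hΩ H hH
  by_cases ht : ∀ x y : Ω, ∃ h ∈ H, h.right x = y
  · rcases isEmpty_or_nonempty Ω with hE | hE
    · have : Subsingleton (Wreath X Ω) :=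
        ⟨fun a b => SemidirectProduct.ext (Subsingleton.elim _ _) (Subsingleton.elim _ _)⟩
      exact GenLE.of_subsingleton _
    · exact hΩ ▸ htrans Ω (hΩ ▸ hn) H hH ht
  push Not at ht
  obtain ⟨x, y, hxy⟩ := ht
  let s : Set Ω := {ω | ∃ h ∈ H, h.right x = ω}
  have hs : ∀ (h : H) ω, (H.subtype h).right ω ∈ s ↔ ω ∈ s := by
    rintro ⟨h, hh⟩ ω
    constructor
    · rintro ⟨g, hg, hgω⟩
      refine ⟨h⁻¹ * g, H.mul_mem (H.inv_mem hh) hg, ?_⟩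
      rw [Wreath.mul_right, Equiv.Perm.mul_apply, hgω]
      change (h.right⁻¹) (h.right ω) = ω
      simp
    · rintro ⟨g, hg, rfl⟩
      exact ⟨h * g, H.mul_mem hh hg, rfl⟩
  have hsc : ∀ (h : H) ω, (H.subtype h).right ω ∈ sᶜ ↔ ω ∈ sᶜ := fun h ω => not_congr (hs h ω)
  let f := Wreath.restrict H.subtype s hs
  let g := (Wreath.restrict H.subtype sᶜ hsc).comp f.ker.subtype
  have hcard : Nat.card s + Nat.card (sᶜ : Set Ω) = n := by
    rw [Nat.card_coe_set_eq, Nat.card_coe_set_eq, Set.ncard_add_ncard_compl, hΩ]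
  have hs0 : 0 < Nat.card s := by
    have : Nonempty s := ⟨⟨x, 1, H.one_mem, rfl⟩⟩
    exact Nat.card_pos
  have hsc0 : 0 < Nat.card (sᶜ : Set Ω) := by
    have : Nonempty (sᶜ : Set Ω) := ⟨⟨y, fun ⟨h, hh, hy⟩ => hxy h hh hy⟩⟩
    exact Nat.card_pos
  have h1 : GenLE (β (Nat.card s)) f.range :=
    ih _ (by omega) (by omega) s rfl f.range (isPGroup_range hH f)
  have h2 : GenLE (β (Nat.card (sᶜ : Set Ω))) g.range :=
    ih _ (by omega) (by omega) _ rfl g.range (isPGroup_range (hH.to_subgroup _) g)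
  have hg : Function.Injective g := by
    rw [injective_iff_map_eq_one]
    rintro ⟨⟨h, hh⟩, hf⟩ hgh
    have hf1 : f ⟨h, hh⟩ = 1 := hf
    have hl : ∀ ω, h.left ω = 1 := fun ω => by
      by_cases hω : ω ∈ s
      · exact congrFun (congrArg SemidirectProduct.left hf1) ⟨ω, hω⟩
      · exact congrFun (congrArg SemidirectProduct.left hgh) ⟨ω, hω⟩
    have hr : ∀ ω, h.right ω = ω := fun ω => by
      by_cases hω : ω ∈ s
      · exact congrArg Subtype.val (Equiv.congr_fun (congrArg SemidirectProduct.right hf1) ⟨ω, hω⟩)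
      · exact congrArg Subtype.val (Equiv.congr_fun (congrArg SemidirectProduct.right hgh) ⟨ω, hω⟩)
    refine Subtype.ext (Subtype.ext (SemidirectProduct.ext (funext hl) (Equiv.ext hr)))
  have h3 := h1.of_range_of_ker f (h2.of_mulEquiv (MonoidHom.ofInjective hg).symm)
  exact h3.mono ((hβ _ _).trans (by rw [hcard]))

/-- A transitive `ℓ`-group of permutations of more than one point contains an element of order `ℓ`
all of whose cycles have length `ℓ`, namely any central element of order `ℓ`; here `R` is a set of
representatives of the cycles. -/
theorem exists_free_of_transitive {ℓ : ℕ} [Fact ℓ.Prime] {Ω : Type*} [Finite Ω] [Nontrivial Ω]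
    (P : Subgroup (Equiv.Perm Ω)) (hP : IsPGroup ℓ P) (ht : ∀ x y : Ω, ∃ σ ∈ P, σ x = y) :
    ∃ ζ ∈ P, ζ ^ ℓ = 1 ∧ ∃ R : Finset Ω, ℓ * R.card = Nat.card Ω ∧
      ∀ ω, ∃ ρ ∈ R, ∃ i : ℕ, ω = (ζ ^ i) ρ := by
  classical
  have hℓ : ℓ.Prime := Fact.out
  have : Nontrivial P := by
    obtain ⟨x, y, hxy⟩ := exists_pair_ne Ω
    obtain ⟨σ, hσ, hσx⟩ := ht x y
    refine ⟨⟨⟨σ, hσ⟩, 1, fun h => hxy ?_⟩⟩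
    have : σ = 1 := congrArg Subtype.val h
    rw [← hσx, this, Equiv.Perm.one_apply]
  have hcn := hP.center_nontrivial
  obtain ⟨c, hc⟩ : ∃ c : Subgroup.center P, orderOf c = ℓ := by
    apply exists_prime_orderOf_dvd_card'
    obtain ⟨k, hk⟩ := IsPGroup.iff_card.mp (hP.to_subgroup (Subgroup.center P))
    rw [hk]
    refine dvd_pow_self _ ?_
    rintro rfl
    rw [pow_zero] at hk
    have := Finite.one_lt_card (α := Subgroup.center P)
    omega
  set ζ : Equiv.Perm Ω := ((c : P) : Equiv.Perm Ω)
  have hζ : orderOf ζ = ℓ := by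
    rw [← hc, ← orderOf_injective (Subgroup.center P).subtype Subtype.val_injective c,
      ← orderOf_injective P.subtype Subtype.val_injective]
    rfl
  have hcomm : ∀ σ ∈ P, Commute σ ζ := fun σ hσ =>
    congrArg Subtype.val (Subgroup.mem_center_iff.mp c.2 ⟨σ, hσ⟩)
  -- the set of fixed points of a power of `ζ` is `P`-invariant, so it is empty or everything
  have hfree : ∀ (k : ℤ) (ω : Ω), (ζ ^ k) ω = ω → ζ ^ k = 1 := by
    intro k ω hω
    ext x
    obtain ⟨σ, hσ, rfl⟩ := ht ω x
    rw [← Equiv.Perm.mul_apply, ← ((hcomm σ hσ).zpow_right k).eq, Equiv.Perm.mul_apply, hω,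
      Equiv.Perm.one_apply]
  let C := Subgroup.zpowers ζ
  have hstab : ∀ ω : Ω, MulAction.stabilizer C ω = ⊥ := by
    intro ω
    rw [eq_bot_iff]
    rintro ⟨_, k, rfl⟩ hk
    exact Subtype.ext (hfree k ω hk)
  let e := MulAction.selfEquivOrbitsQuotientProd hstab
  let Ω' := Quotient (MulAction.orbitRel C Ω)
  have : Fintype Ω' := Fintype.ofFinite _
  have hcard : Nat.card Ω = ℓ * Fintype.card Ω' := by
    rw [Nat.card_congr e, Nat.card_prod, Nat.card_eq_fintype_card (α := Ω'), Nat.card_zpowers, hζ,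
      mul_comm]
  refine ⟨ζ, (c : P).2, hζ ▸ pow_orderOf_eq_one ζ, Finset.univ.image (Quotient.out : Ω' → Ω),
    ?_, fun ω => ?_⟩
  · rw [Finset.card_image_of_injective _ Quotient.out_injective, Finset.card_univ, hcard]
  · obtain ⟨⟨τ, hτ⟩, hτω⟩ := Quotient.exact (Quotient.out_eq (⟦ω⟧ : Ω')).symm
    obtain ⟨i, rfl⟩ := (mem_powers_iff_mem_zpowers (x := ζ)).mpr hτ
    exact ⟨_, Finset.mem_image_of_mem _ (Finset.mem_univ _), i, hτω.symm⟩

namespace Wreath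

variable {X Ω : Type*} [CommGroup X]

/-- The permutation action of a subgroup of a wreath product. -/
def permHom (H : Subgroup (Wreath X Ω)) : H →* Equiv.Perm Ω :=
  SemidirectProduct.rightHom.comp H.subtype

theorem right_eq_one {H : Subgroup (Wreath X Ω)} {a : H} (ha : a ∈ (permHom H).ker) :
    (a : Wreath X Ω).right = 1 := ha

/-- The coordinate at the point `ω` of the elements that fix all points. -/
def coord (H : Subgroup (Wreath X Ω)) (ω : Ω) : (permHom H).ker →* X where
  toFun a := ((a : H) : Wreath X Ω).left ω
  map_one' := rfl
  map_mul' a b := by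
    simp only [Subgroup.coe_mul, mul_left_apply, right_eq_one a.2]
    rfl

theorem eq_one_of_coord {H : Subgroup (Wreath X Ω)} {a : (permHom H).ker}
    (ha : ∀ ω, coord H ω a = 1) : a = 1 :=
  Subtype.ext (Subtype.ext (SemidirectProduct.ext (funext ha) (right_eq_one a.2)))

theorem comm_of_mem_ker {H : Subgroup (Wreath X Ω)} :
    ∀ a ∈ (permHom H).ker, ∀ b ∈ (permHom H).ker, a * b = b * a := by
  intro a ha b hb
  refine Subtype.ext (SemidirectProduct.ext (funext fun ω => ?_) ?_)
  · rw [Subgroup.coe_mul, Subgroup.coe_mul, mul_left_apply, mul_left_apply, right_eq_one ha,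
      right_eq_one hb, mul_comm]
    rfl
  · rw [Subgroup.coe_mul, Subgroup.coe_mul, mul_right, mul_right, right_eq_one ha,
      right_eq_one hb]

theorem left_conj {H : Subgroup (Wreath X Ω)} (z : H) {a : H} (ha : a ∈ (permHom H).ker) (ω : Ω) :
    ((z * a * z⁻¹ : H) : Wreath X Ω).left ((z : Wreath X Ω).right ω) =
      (a : Wreath X Ω).left ω := by
  have h1 : ((z : Wreath X Ω) * (z : Wreath X Ω)⁻¹).left ((z : Wreath X Ω).right ω) = 1 := by
    rw [mul_inv_cancel]; rfl
  rw [mul_left_apply] at h1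
  simp only [Subgroup.coe_mul, Subgroup.coe_inv, mul_left_apply, mul_right, right_eq_one ha,
    mul_one] at h1 ⊢
  rw [mul_right_comm, h1, one_mul]
  simp

theorem genLE_ker [IsCyclic X] [Finite Ω] (H : Subgroup (Wreath X Ω)) :
    GenLE (Nat.card Ω) (permHom H).ker :=
  GenLE.of_separating (coord H) fun _ => eq_one_of_coord

theorem genLE_of_subsingleton [IsCyclic X] [Finite Ω] [Subsingleton Ω]
    (H : Subgroup (Wreath X Ω)) : GenLE (Nat.card Ω) H := by
  have h : GenLE 0 (permHom H).range :=
    (GenLE.of_subsingleton (G := Equiv.Perm Ω) 0).of_surjective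
      (1 : Equiv.Perm Ω →* (permHom H).range) fun x => ⟨1, Subsingleton.elim _ _⟩
  simpa using h.of_range_of_ker _ (genLE_ker H)

/-- Elements of order dividing `ℓ` that are fixed by `z` are determined by their coordinates, all
of order dividing `ℓ`, on a set of representatives of the cycles of `z`. -/
theorem card_centralizer_le [IsCyclic X] [Finite X] [Finite Ω] {ℓ : ℕ} (hℓ : 0 < ℓ)
    {H : Subgroup (Wreath X Ω)} (B : Subgroup H) (hB : B ≤ (permHom H).ker) (z : H) (R : Finset Ω)
    (hR : ∀ ω, ∃ ρ ∈ R, ∃ i : ℕ, ω = ((z : Wreath X Ω).right ^ i) ρ)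
    (hpow : ∀ b : H, b ∈ B → z * b * z⁻¹ = b → ∀ ρ ∈ R, (b : Wreath X Ω).left ρ ^ ℓ = 1) :
    Nat.card {b : B // z * b * z⁻¹ = b} ≤ ℓ ^ R.card := by
  classical
  have : Fintype X := Fintype.ofFinite X
  let g : {b : B // z * b * z⁻¹ = b} → (R → {x : X // x ^ ℓ = 1}) := fun b ρ =>
    ⟨((b : B) : Wreath X Ω).left ρ, hpow _ b.1.2 b.2 ρ ρ.2⟩
  have hconst : ∀ (b : {b : B // z * b * z⁻¹ = b}) (i : ℕ) (ρ : Ω),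
      ((b : B) : Wreath X Ω).left (((z : Wreath X Ω).right ^ i) ρ) =
        ((b : B) : Wreath X Ω).left ρ := by
    intro b i ρ
    induction i with
    | zero => simp
    | succ i ih =>
      have h := left_conj z (hB b.1.2) (((z : Wreath X Ω).right ^ i) ρ)
      rw [b.2] at h
      rw [pow_succ', Equiv.Perm.mul_apply, h, ih]
  have hg : Function.Injective g := by
    intro b c hbc
    refine Subtype.ext (Subtype.ext (Subtype.ext (SemidirectProduct.ext (funext fun ω => ?_) ?_)))
    · obtain ⟨ρ, hρ, i, rfl⟩ := hR ω
      rw [hconst, hconst]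
      exact congrArg Subtype.val (congrFun hbc ⟨ρ, hρ⟩)
    · rw [right_eq_one (hB b.1.2), right_eq_one (hB c.1.2)]
  have hX : Nat.card {x : X // x ^ ℓ = 1} ≤ ℓ := by
    rw [Nat.card_eq_fintype_card, Fintype.card_subtype]
    exact IsCyclic.card_pow_eq_one_le hℓ
  refine (Nat.card_le_card_of_injective g hg).trans ?_
  rw [Nat.card_pi, Finset.prod_const, Finset.card_univ, Fintype.card_coe]
  exact Nat.pow_le_pow_left hX _

/-- A transitive `ℓ`-subgroup of `C_ℓ ≀ Sym(Ω)` is generated by `|Ω|` elements if its image in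
`Sym(Ω)` is generated by `|Ω| / ℓ` elements. -/
theorem genLE_transitive_of_card {ℓ : ℕ} [Fact ℓ.Prime] (hX : Nat.card X = ℓ) [Finite Ω]
    (H : Subgroup (Wreath X Ω)) (hH : IsPGroup ℓ H) (ht : ∀ x y : Ω, ∃ h ∈ H, h.right x = y)
    (hP : GenLE (Nat.card Ω / ℓ) (permHom H).range) : GenLE (Nat.card Ω) H := by
  have hℓ : ℓ.Prime := Fact.out
  have : IsCyclic X := isCyclic_of_prime_card hX
  have : Finite X := Nat.finite_of_card_ne_zero (hX ▸ hℓ.ne_zero)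
  rcases subsingleton_or_nontrivial Ω with hΩ | hΩ
  · exact genLE_of_subsingleton H
  obtain ⟨_, ⟨z, rfl⟩, -, R, hRc, hR⟩ := exists_free_of_transitive (permHom H).range
    (isPGroup_range hH _) fun x y => let ⟨h, hh, e⟩ := ht x y; ⟨h.right, ⟨⟨h, hh⟩, rfl⟩, e⟩
  have hk := card_centralizer_le hℓ.pos (permHom H).ker le_rfl z R hR
    fun b _ _ ρ _ => hX ▸ pow_card_eq_one'
  refine (GenLE.of_ker_of_centralizer (c := 0) hH (permHom H) hP comm_of_mem_ker _ le_rfl z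
    (fun b hb => (inferInstance : (permHom H).ker.Normal).conj_mem b hb z) hk ∅ (by simp)
    le_sup_right).mono ?_
  rw [← hRc, Nat.mul_div_cancel_left _ hℓ.pos]
  nlinarith [hℓ.two_le]

/-- A transitive `ℓ`-subgroup of `X ≀ Sym(Ω)`, with `X` cyclic and `ℓ ≥ 3`, is generated by `|Ω|`
elements if its image in `Sym(Ω)` is generated by `|Ω| / ℓ` elements. With `z` as in
`exists_free_of_transitive`, the base group modulo the kernel `B` of the norm of `z` needs
`|Ω| / ℓ` generators, and so does `B` as a group with an action of `z`. -/
theorem genLE_transitive_of_isCyclic {ℓ : ℕ} [Fact ℓ.Prime] (hℓ3 : 3 ≤ ℓ) [IsCyclic X] [Finite X]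
    [Finite Ω] (H : Subgroup (Wreath X Ω)) (hH : IsPGroup ℓ H)
    (ht : ∀ x y : Ω, ∃ h ∈ H, h.right x = y)
    (hP : GenLE (Nat.card Ω / ℓ) (permHom H).range) : GenLE (Nat.card Ω) H := by
  classical
  have hℓ : ℓ.Prime := Fact.out
  rcases subsingleton_or_nontrivial Ω with hΩ | hΩ
  · exact genLE_of_subsingleton H
  obtain ⟨_, ⟨z, rfl⟩, hzℓ, R, hRc, hR⟩ := exists_free_of_transitive (permHom H).range
    (isPGroup_range hH _) fun x y => let ⟨h, hh, e⟩ := ht x y; ⟨h.right, ⟨⟨h, hh⟩, rfl⟩, e⟩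
  set ζ := permHom H z
  -- the coordinates of the norm `∏ zⁱ a z⁻ⁱ` at the representatives of the cycles of `z`
  let χ : (permHom H).ker →* (R → X) :=
    { toFun := fun a ρ => ∏ i ∈ Finset.range ℓ, coord H ((ζ ^ i) ρ) a
      map_one' := by ext; simp
      map_mul' := fun a b => by ext; simp [Finset.prod_mul_distrib] }
  have hχ : ∀ a ρ, χ a ρ = ∏ i ∈ Finset.range ℓ, coord H ((ζ ^ i) ρ) a := fun a ρ => rfl
  have h1 : GenLE R.card χ.range := by
    have h := GenLE.of_separating (G := χ.range)
      (fun ρ => (Pi.evalMonoidHom (fun _ : R => X) ρ).comp χ.range.subtype)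
      fun a ha => Subtype.ext (funext ha)
    simpa using h
  obtain ⟨T, hT, hTc⟩ := h1.exists_closure_sup_ker χ
  let B : Subgroup H := χ.ker.map (permHom H).ker.subtype
  have hBA : B ≤ (permHom H).ker := Subgroup.map_subtype_le _
  have hmem : ∀ b (hb : b ∈ (permHom H).ker), b ∈ B ↔ χ ⟨b, hb⟩ = 1 := fun b hb =>
    ⟨fun ⟨c, hc, hcb⟩ => by
      have : c = ⟨b, hb⟩ := Subtype.ext hcb
      exact this ▸ hc, fun h => ⟨⟨b, hb⟩, h, rfl⟩⟩
  have hz : ∀ b ∈ B, z * b * z⁻¹ ∈ B := by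
    intro b hb
    have hb' : z * b * z⁻¹ ∈ (permHom H).ker :=
      (inferInstance : (permHom H).ker.Normal).conj_mem b (hBA hb) z
    rw [hmem _ hb']
    funext ρ
    have h2 : ∀ i, coord H ((ζ ^ (i + 1)) ρ) ⟨z * b * z⁻¹, hb'⟩ =
        coord H ((ζ ^ i) ρ) ⟨b, hBA hb⟩ := fun i => by
      rw [pow_succ', Equiv.Perm.mul_apply]
      exact left_conj z (hBA hb) _
    have h3 := congrFun ((hmem b (hBA hb)).mp hb) ρ
    rw [hχ] at h3 ⊢
    rw [← h3, ← Finset.prod_congr rfl fun i _ => h2 i]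
    -- both sides run over the same cycle of `ζ`, since `ζ ^ ℓ = 1`
    obtain ⟨k, hk⟩ : ∃ k, ℓ = k + 1 := ⟨ℓ - 1, by have := hℓ.pos; omega⟩
    rw [hk, Finset.prod_range_succ', Finset.prod_range_succ, ← hk, hzℓ, pow_zero]
  have hk := card_centralizer_le hℓ.pos B hBA z R hR fun b hb hbz ρ hρ => by
    have h4 := congrFun ((hmem b (hBA hb)).mp hb) ⟨ρ, hρ⟩
    rw [hχ] at h4
    have h5 : ∀ i : ℕ, coord H ((ζ ^ i) ρ) ⟨b, hBA hb⟩ = (b : Wreath X Ω).left ρ := by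
      intro i
      induction i with
      | zero => rfl
      | succ i ih =>
        rw [pow_succ', Equiv.Perm.mul_apply, ← ih]
        have := left_conj z (hBA hb) ((ζ ^ i) ρ)
        rw [hbz] at this
        exact this
    rw [Finset.prod_congr rfl fun i _ => h5 i, Finset.prod_const, Finset.card_range] at h4
    exact h4
  refine (GenLE.of_ker_of_centralizer hH (permHom H) hP comm_of_mem_ker B hBA z hz hk
    (T.image (permHom H).ker.subtype) (Finset.card_image_le.trans hT) ?_).mono ?_
  · rw [Finset.coe_image, ← MonoidHom.map_closure, ← Subgroup.map_sup, hTc,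
      ← MonoidHom.range_eq_map,
      Subgroup.range_subtype]
  · rw [← hRc, Nat.mul_div_cancel_left _ hℓ.pos]
    nlinarith

end Wreath

/-- If `W` embeds in `G` and the orders of `W` and `G` are divisible by the same power of `ℓ`, then
every `ℓ`-subgroup of `G` is isomorphic to a subgroup of `W`, by Sylow's theorems. -/
theorem exists_subgroup_mulEquiv {ℓ : ℕ} [Fact ℓ.Prime] {W G : Type*} [Group W] [Group G]
    [Finite G] (φ : W →* G) (hφ : Function.Injective φ) (hi : ¬ ℓ ∣ φ.range.index)
    (H : Subgroup G) (hH : IsPGroup ℓ H) : ∃ H' : Subgroup W, Nonempty (H' ≃* H) := by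
  have hℓ : ℓ.Prime := Fact.out
  have : Finite W := Finite.of_injective φ hφ
  let P : Sylow ℓ W := default
  have hP : ¬ ℓ ∣ ((P : Subgroup W).map φ).index := by
    rw [Subgroup.index_map, (MonoidHom.ker_eq_bot_iff φ).mpr hφ, sup_bot_eq, hℓ.dvd_mul]
    exact not_or.mpr ⟨P.not_dvd_index, hi⟩
  let S : Sylow ℓ G := (P.isPGroup'.map φ).toSylow hP
  obtain ⟨Q, hQ⟩ := hH.exists_le_sylow
  obtain ⟨g, hg⟩ := MulAction.exists_smul_eq G Q S
  have hle : H.map (MulAut.conj g).toMonoidHom ≤ φ.range := by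
    have h1 : (Q : Subgroup G).map (MulAut.conj g).toMonoidHom = (P : Subgroup W).map φ :=
      congrArg (fun S : Sylow ℓ G => (S : Subgroup G)) hg
    exact (Subgroup.map_mono hQ).trans (h1.le.trans (Subgroup.map_le_range _ _))
  refine ⟨(H.map (MulAut.conj g).toMonoidHom).comap φ, ⟨?_⟩⟩
  refine (Subgroup.equivMapOfInjective _ φ hφ).trans
    ((MulEquiv.subgroupCongr (Subgroup.map_comap_eq_self hle)).trans
      (Subgroup.equivMapOfInjective H _ (MulAut.conj g).injective).symm)

theorem not_dvd_index_range {ℓ : ℕ} [Fact ℓ.Prime] {W G : Type*} [Group W] [Group G]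
    [Finite G] (φ : W →* G) (hφ : Function.Injective φ)
    (h : padicValNat ℓ (Nat.card W) = padicValNat ℓ (Nat.card G)) : ¬ ℓ ∣ φ.range.index := by
  have h1 : Nat.card W * φ.range.index = Nat.card G := by
    rw [Nat.card_congr (MonoidHom.ofInjective hφ).toEquiv, Subgroup.card_mul_index]
  have : Finite W := Finite.of_injective φ hφ
  rw [← h1, padicValNat.mul Nat.card_pos.ne' Subgroup.index_ne_zero_of_finite] at h
  intro hd
  have := one_le_padicValNat_of_dvd (p := ℓ) Subgroup.index_ne_zero_of_finite hd
  omega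

namespace Wreath

theorem card {X Ω : Type*} [Group X] [Finite Ω] :
    Nat.card (Wreath X Ω) = Nat.card X ^ Nat.card Ω * (Nat.card Ω).factorial := by
  have := Fintype.ofFinite Ω
  rw [SemidirectProduct.card, Nat.card_perm, Nat.card_fun]

/-- The imprimitive action of `X ≀ Sym(Ω)` on the disjoint union of copies of `X` indexed by
`Ω`. -/
def toPermProd (X Ω : Type*) [Group X] : Wreath X Ω →* Equiv.Perm (Ω × X) where
  toFun w :=
    { toFun := fun a => (w.right a.1, w.left (w.right a.1) * a.2)
      invFun := fun a => (w.right⁻¹ a.1, (w.left a.1)⁻¹ * a.2)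
      left_inv := fun a => by simp
      right_inv := fun a => by simp }
  map_one' := by ext a <;> simp
  map_mul' v w := by
    ext a
    · rfl
    · simp [mul_left_apply, mul_assoc]

theorem toPermProd_injective (X Ω : Type*) [Group X] :
    Function.Injective (toPermProd X Ω) := by
  rw [injective_iff_map_eq_one]
  intro w hw
  have h : ∀ a, (w.right a.1, w.left (w.right a.1) * a.2) = a := fun a => Equiv.congr_fun hw a
  have hr : ∀ ω, w.right ω = ω := fun ω => congrArg Prod.fst (h (ω, 1))
  refine SemidirectProduct.ext (funext fun ω => ?_) (Equiv.ext hr)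
  have := congrArg Prod.snd (h (ω, 1))
  simpa [hr] using this

end Wreath

/-- Every `ℓ`-group of permutations of `n` points is generated by `n / ℓ` elements. Since `n!` and
the order of `C_ℓ ≀ Sym(n / ℓ)` are divisible by the same power of `ℓ`, such a group is isomorphic
to a subgroup of this wreath product, where induction applies. -/
theorem genLE_perm {ℓ : ℕ} [Fact ℓ.Prime] (n : ℕ) :
    ∀ (Ω : Type) [Finite Ω], Nat.card Ω = n → ∀ H : Subgroup (Equiv.Perm Ω), IsPGroup ℓ H →
      GenLE (n / ℓ) H := by
  have hℓ : ℓ.Prime := Fact.out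
  induction n using Nat.strong_induction_on with
  | _ n ih =>
  intro Ω _ hΩ H hH
  rcases n.eq_zero_or_pos with rfl | hn
  · have : IsEmpty Ω := (Finite.card_eq_zero_iff).mp hΩ
    exact GenLE.of_subsingleton _
  let X := Multiplicative (ZMod ℓ)
  have hX : Nat.card X = ℓ := by
    rw [Nat.card_congr Multiplicative.toAdd, Nat.card_zmod]
  have : Finite X := Nat.finite_of_card_ne_zero (hX ▸ hℓ.ne_zero)
  obtain ⟨ι⟩ : Nonempty (Fin (n / ℓ) × X ↪ Ω) := by
    have := Fintype.ofFinite Ω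
    have := Fintype.ofFinite X
    refine Function.Embedding.nonempty_of_card_le ?_
    rw [← Nat.card_eq_fintype_card, ← Nat.card_eq_fintype_card, Nat.card_prod, hΩ, hX,
      Nat.card_eq_fintype_card, Fintype.card_fin]
    exact Nat.div_mul_le_self n ℓ
  let φ : Wreath X (Fin (n / ℓ)) →* Equiv.Perm Ω :=
    (Equiv.Perm.viaEmbeddingHom ι).comp (Wreath.toPermProd X (Fin (n / ℓ)))
  have hφ : Function.Injective φ :=
    (Equiv.Perm.viaEmbeddingHom_injective ι).comp (Wreath.toPermProd_injective _ _)
  have hi : ¬ ℓ ∣ φ.range.index := by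
    refine not_dvd_index_range φ hφ ?_
    rw [Wreath.card, Nat.card_perm, hΩ, hX, Nat.card_eq_fintype_card, Fintype.card_fin,
      padicValNat.mul (pow_ne_zero _ hℓ.ne_zero) (Nat.factorial_ne_zero _), padicValNat.prime_pow,
      add_comm, ← padicValNat_factorial_mul,
      ← padicValNat_factorial_mul_add _ (Nat.mod_lt n hℓ.pos),
      Nat.div_add_mod]
  obtain ⟨H', ⟨e⟩⟩ := exists_subgroup_mulEquiv φ hφ hi H hH
  have hlt : n / ℓ < n := Nat.div_lt_self hn hℓ.one_lt
  refine GenLE.of_mulEquiv ?_ e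
  refine genLE_wreath_of_transitive (ℓ := ℓ) id (fun _ _ => le_rfl) (n / ℓ)
    (fun Ω' _ _ hΩ' K hK ht => ?_) (n / ℓ) le_rfl (Fin (n / ℓ)) (by simp) H'
    (hH.of_equiv e.symm)
  exact Wreath.genLE_transitive_of_card hX K hK ht
    (ih _ (hΩ'.trans_lt hlt) Ω' rfl _ (isPGroup_range hK _))

namespace Wreath

variable {ℓ : ℕ} [Fact ℓ.Prime] {X : Type*}

theorem genLE_of_card [CommGroup X] (hX : Nat.card X = ℓ) (Ω : Type) [Finite Ω]
    (H : Subgroup (Wreath X Ω)) (hH : IsPGroup ℓ H) : GenLE (Nat.card Ω) H := by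
  have : Finite X := Nat.finite_of_card_ne_zero (hX ▸ (Fact.out : ℓ.Prime).ne_zero)
  exact genLE_wreath_of_transitive (ℓ := ℓ) id (fun _ _ => le_rfl) (Nat.card Ω)
    (fun Ω' _ _ _ K hK ht => genLE_transitive_of_card hX K hK ht
      (genLE_perm _ Ω' rfl _ (isPGroup_range hK _))) _ le_rfl Ω rfl H hH

theorem genLE_of_isCyclic_of_three_le [CommGroup X] [IsCyclic X] [Finite X] (hℓ : 3 ≤ ℓ)
    (Ω : Type) [Finite Ω] (H : Subgroup (Wreath X Ω)) (hH : IsPGroup ℓ H) :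
    GenLE (Nat.card Ω) H :=
  genLE_wreath_of_transitive (ℓ := ℓ) id (fun _ _ => le_rfl) (Nat.card Ω)
    (fun Ω' _ _ _ K hK ht => genLE_transitive_of_isCyclic hℓ K hK ht
      (genLE_perm _ Ω' rfl _ (isPGroup_range hK _))) _ le_rfl Ω rfl H hH

theorem genLE_of_isCyclic [CommGroup X] [IsCyclic X] (Ω : Type) [Finite Ω]
    (H : Subgroup (Wreath X Ω)) (hH : IsPGroup ℓ H) :
    GenLE (Nat.card Ω / ℓ + Nat.card Ω) H :=
  GenLE.of_range_of_ker (permHom H) (genLE_perm _ Ω rfl _ (isPGroup_range hH _)) (genLE_ker H)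

/-- The homomorphism of wreath products induced by a homomorphism of base groups. -/
def map {Y : Type*} [Group X] [Group Y] (f : X →* Y) (Ω : Type*) : Wreath X Ω →* Wreath Y Ω where
  toFun w := ⟨fun ω => f (w.left ω), w.right⟩
  map_one' := by ext <;> simp
  map_mul' v w := by
    ext ω
    · simp [mul_left_apply]
    · rfl

/-- If `X` is an extension of a group of order `ℓ` by a cyclic group, the `ℓ`-subgroups of
`X ≀ Sym(Ω)` are generated by `2 |Ω|` elements. -/
theorem genLE_of_isCyclic_ker {Y : Type*} [Group X] [CommGroup Y] (hY : Nat.card Y = ℓ)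
    (f : X →* Y) [IsCyclic f.ker] (Ω : Type) [Finite Ω]
    (H : Subgroup (Wreath X Ω)) (hH : IsPGroup ℓ H) :
    GenLE (Nat.card Ω + Nat.card Ω) H := by
  let g := (map f Ω).comp H.subtype
  have hl : ∀ (a : g.ker) ω, ((a : H) : Wreath X Ω).left ω ∈ f.ker := fun a ω =>
    congrFun (congrArg SemidirectProduct.left a.2) ω
  have hr : ∀ a : g.ker, ((a : H) : Wreath X Ω).right = 1 := fun a =>
    congrArg SemidirectProduct.right a.2
  refine GenLE.of_range_of_ker g (genLE_of_card hY Ω _ (isPGroup_range hH g)) ?_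
  let χ : Ω → g.ker →* f.ker := fun ω =>
    { toFun := fun a => ⟨((a : H) : Wreath X Ω).left ω, hl a ω⟩
      map_one' := rfl
      map_mul' := fun a b => Subtype.ext (by
        simp only [Subgroup.coe_mul, mul_left_apply, hr a]
        rfl) }
  refine GenLE.of_separating χ fun a ha => Subtype.ext (Subtype.ext ?_)
  exact SemidirectProduct.ext (funext fun ω => congrArg Subtype.val (ha ω)) (hr a)

end Wreath

/-! ### The power of `ℓ` dividing the order of `GL_d(𝔽_p)` -/

theorem padicValNat_pow_sub_one_of_odd {ℓ x t : ℕ} [Fact ℓ.Prime] (hℓ : Odd ℓ) (hx : 1 < x)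
    (h : ℓ ∣ x - 1) (ht : t ≠ 0) :
    padicValNat ℓ (x ^ t - 1) = padicValNat ℓ (x - 1) + padicValNat ℓ t := by
  have hℓp : ℓ.Prime := Fact.out
  have hn : ¬ ℓ ∣ x := fun hd => hℓp.one_lt.ne' (Nat.dvd_one.mp (by
    have := Nat.dvd_sub hd h
    rwa [Nat.sub_sub_self hx.le] at this))
  simpa using padicValNat.pow_sub_pow hℓ (y := 1) hx h hn ht

theorem padicValNat_two_pow_sub_one {x t : ℕ} (hx : 1 < x) (h : 4 ∣ x - 1) (ht : t ≠ 0) :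
    padicValNat 2 (x ^ t - 1) = padicValNat 2 (x - 1) + padicValNat 2 t := by
  have hxt : 1 < x ^ t := Nat.one_lt_pow ht hx
  have hi : ¬ (2 : ℤ) ∣ x := by omega
  have h4 : (4 : ℤ) ∣ (x : ℤ) - 1 := by omega
  have key := Int.two_pow_sub_pow' (x := (x : ℤ)) (y := 1) t h4 hi
  rw [one_pow] at key
  rw [← Nat.cast_inj (R := ℕ∞), Nat.cast_add, padicValNat_eq_emultiplicity (by omega),
    padicValNat_eq_emultiplicity (by omega), padicValNat_eq_emultiplicity ht,
    ← Int.natCast_emultiplicity, ← Int.natCast_emultiplicity, ← Int.natCast_emultiplicity]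
  push_cast [hx.le, hxt.le]
  exact key

theorem padicValNat_two_odd_pow_sub_one {p j : ℕ} (hp : p % 4 = 3) (hj : Odd j) :
    padicValNat 2 (p ^ j - 1) = 1 := by
  have h : p ^ j % 4 = 3 := by
    obtain ⟨k, rfl⟩ := hj
    rw [pow_succ, pow_mul, Nat.mul_mod, Nat.pow_mod, Nat.pow_mod p 2, hp]
    norm_num
  obtain ⟨a, ha⟩ : ∃ a, p ^ j - 1 = 2 * (2 * a + 1) := ⟨p ^ j / 4, by omega⟩
  rw [ha, padicValNat.mul (by norm_num) (by omega), padicValNat.self (by norm_num),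
    padicValNat.eq_zero_of_not_dvd (by omega)]

theorem padicValNat_card_GL {p ℓ : ℕ} [Fact p.Prime] [Fact ℓ.Prime] (hℓp : ℓ ≠ p) (d : ℕ) :
    padicValNat ℓ (Nat.card (Matrix.GeneralLinearGroup (Fin d) (ZMod p))) =
      ∑ j ∈ Finset.range d, padicValNat ℓ (p ^ (j + 1) - 1) := by
  have hp : p.Prime := Fact.out
  have hone : ∀ j, 1 < p ^ (j + 1) := fun j => Nat.one_lt_pow (by omega) hp.one_lt
  have h : Nat.card (Matrix.GeneralLinearGroup (Fin d) (ZMod p)) =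
      p ^ (∑ i ∈ Finset.range d, i) * ∏ j ∈ Finset.range d, (p ^ (j + 1) - 1) := by
    rw [Matrix.card_GL_field, ZMod.card, Finset.prod_range, ← Finset.prod_pow_eq_pow_sum,
      Finset.prod_range, ← Equiv.prod_comp Fin.revPerm (fun j : Fin d => p ^ ((j : ℕ) + 1) - 1),
      ← Finset.prod_mul_distrib]
    refine Finset.prod_congr rfl fun i _ => ?_
    rw [Nat.mul_sub, mul_one, ← pow_add]
    congr 2
    simp only [Fin.revPerm_apply, Fin.val_rev]
    omega
  rw [h, padicValNat.mul (pow_ne_zero _ hp.ne_zero)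
    (Finset.prod_ne_zero_iff.mpr fun j _ => by have := hone j; omega),
    padicValNat.pow, padicValNat_primes hℓp, mul_zero, zero_add]
  clear h
  induction d with
  | zero => simp
  | succ d ih =>
    rw [Finset.prod_range_succ, Finset.sum_range_succ, padicValNat.mul
      (Finset.prod_ne_zero_iff.mpr fun j _ => by have := hone j; omega)
      (by have := hone d; omega), ih]

/-- The power of `ℓ` in the order of `GL_d(𝔽_p)` if the factors `p ^ j - 1` with `m ∤ j` contribute
a constant and the factors `p ^ (m t) - 1` follow the lifting-the-exponent rule. -/
theorem padicValNat_card_GL_eq {p ℓ : ℕ} [Fact p.Prime] [Fact ℓ.Prime] (hℓp : ℓ ≠ p) {m c : ℕ}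
    (hc : ∀ j, ¬ m ∣ j → padicValNat ℓ (p ^ j - 1) = c)
    (hl : ∀ t ≠ 0, padicValNat ℓ ((p ^ m) ^ t - 1) = padicValNat ℓ (p ^ m - 1) + padicValNat ℓ t)
    (d : ℕ) :
    padicValNat ℓ (Nat.card (Matrix.GeneralLinearGroup (Fin d) (ZMod p))) =
      d / m * padicValNat ℓ (p ^ m - 1) + padicValNat ℓ (d / m).factorial + c * (d - d / m) := by
  rw [padicValNat_card_GL hℓp]
  induction d with
  | zero => simp
  | succ d ih =>
    have hle := Nat.div_le_self d m
    rw [Finset.sum_range_succ, ih, Nat.succ_div]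
    split_ifs with hd
    · have ht : d + 1 = m * (d / m + 1) := by
        rw [← Nat.succ_div_of_dvd hd, Nat.mul_div_cancel' hd]
      rw [ht, pow_mul, hl _ (Nat.succ_ne_zero _), Nat.factorial_succ,
        padicValNat.mul (Nat.succ_ne_zero _) (Nat.factorial_ne_zero _), ← ht, Nat.add_sub_add_right]
      ring
    · rw [hc _ hd, add_zero, Nat.succ_sub hle, Nat.mul_succ]
      ring

/-! ### Linear representations of wreath products -/

section Linear

variable {k V V' X Y : Type*} [Field k] [AddCommGroup V] [Module k V] [AddCommGroup V']
  [Module k V'] [Group X] [Group Y]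

namespace Wreath

/-- The representation of `X ≀ Sym(Ω)` on `V ^ Ω` induced by a representation of `X` on `V`. -/
def toLinear (ρ : X →* (V ≃ₗ[k] V)) (Ω : Type*) : Wreath X Ω →* ((Ω → V) ≃ₗ[k] (Ω → V)) where
  toFun w :=
    { toFun := fun v ω => ρ (w.left ω) (v (w.right⁻¹ ω))
      map_add' := fun u v => by ext; simp
      map_smul' := fun c v => by ext; simp
      invFun := fun v ω => (ρ (w.left (w.right ω)))⁻¹ (v (w.right ω))
      left_inv := fun v => by
        ext ω
        have h : w.right⁻¹ (w.right ω) = ω := w.right.symm_apply_apply ω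
        simp only [h]
        exact (ρ (w.left (w.right ω))).symm_apply_apply _
      right_inv := fun v => by
        ext ω
        have h : w.right (w.right⁻¹ ω) = ω := w.right.apply_symm_apply ω
        simp only [h]
        exact (ρ (w.left ω)).apply_symm_apply _ }
  map_one' := by ext; simp
  map_mul' v w := by
    ext u ω
    simp [mul_left_apply]

theorem toLinear_injective [Nontrivial V] {ρ : X →* (V ≃ₗ[k] V)} (hρ : Function.Injective ρ)
    (Ω : Type*) : Function.Injective (toLinear ρ Ω) := by
  classical
  rw [injective_iff_map_eq_one]
  intro w hw
  have h : ∀ (v : Ω → V) ω, ρ (w.left ω) (v (w.right⁻¹ ω)) = v ω := fun v ω =>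
    congrFun (LinearEquiv.congr_fun hw v) ω
  obtain ⟨v, hv⟩ := exists_ne (0 : V)
  have hr : ∀ ω, w.right⁻¹ ω = ω := by
    intro ω
    by_contra hne
    have := h (Pi.single ω v) ω
    rw [Pi.single_eq_of_ne hne, map_zero, Pi.single_eq_same] at this
    exact hv this.symm
  refine SemidirectProduct.ext (funext fun ω => hρ ?_) (inv_eq_one.mp (Equiv.ext hr))
  ext u
  have := h (fun _ => u) ω
  simpa using this

end Wreath

/-- The direct sum of two representations, as a representation of the product group. -/
def prodLinear (ρ : X →* (V ≃ₗ[k] V)) (ρ' : Y →* (V' ≃ₗ[k] V')) :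
    X × Y →* ((V × V') ≃ₗ[k] (V × V')) where
  toFun a := (ρ a.1).prodCongr (ρ' a.2)
  map_one' := by ext <;> simp
  map_mul' a b := by
    refine LinearEquiv.ext fun x => ?_
    simp

theorem prodLinear_injective {ρ : X →* (V ≃ₗ[k] V)} {ρ' : Y →* (V' ≃ₗ[k] V')}
    (hρ : Function.Injective ρ) (hρ' : Function.Injective ρ') :
    Function.Injective (prodLinear ρ ρ') := by
  rw [injective_iff_map_eq_one]
  intro a ha
  have h : ∀ x, (ρ a.1 x.1, ρ' a.2 x.2) = x := fun x => LinearEquiv.congr_fun ha x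
  refine Prod.ext (hρ ?_) (hρ' ?_)
  · ext x
    simpa using congrArg Prod.fst (h (x, 0))
  · ext x
    simpa using congrArg Prod.snd (h (0, x))

theorem exists_hom_GL [Module.Finite k V] {d : ℕ} (hd : Module.finrank k V = d)
    (ρ : X →* (V ≃ₗ[k] V)) (hρ : Function.Injective ρ) :
    ∃ φ : X →* Matrix.GeneralLinearGroup (Fin d) k, Function.Injective φ := by
  let e : Matrix.GeneralLinearGroup (Fin d) k ≃* (V ≃ₗ[k] V) :=
    (Matrix.GeneralLinearGroup.toLin' (Module.finBasisOfFinrankEq k V hd)).trans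
      (LinearMap.GeneralLinearGroup.generalLinearEquiv k V)
  exact ⟨e.symm.toMonoidHom.comp ρ, e.symm.injective.comp hρ⟩

theorem Wreath.exists_hom_GL [Module.Finite k V] [Nontrivial V] [Module.Finite k V']
    (ρ : X →* (V ≃ₗ[k] V)) (hρ : Function.Injective ρ) (ρ' : Y →* (V' ≃ₗ[k] V'))
    (hρ' : Function.Injective ρ') (n : ℕ) {d : ℕ}
    (hd : n * Module.finrank k V + Module.finrank k V' = d) :
    ∃ φ : Wreath X (Fin n) × Y →* Matrix.GeneralLinearGroup (Fin d) k, Function.Injective φ := by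
  refine PadicLieRank.exists_hom_GL ?_ (prodLinear (Wreath.toLinear ρ (Fin n)) ρ')
    (prodLinear_injective (Wreath.toLinear_injective hρ _) hρ')
  rw [Module.finrank_prod, Module.finrank_pi_fintype]
  simpa using hd

theorem toModuleAut_units_injective (k E : Type*) [Field k] [Field E] [Algebra k E] :
    Function.Injective (DistribMulAction.toModuleAut k E (S := Eˣ)) := by
  intro a b hab
  have := LinearEquiv.congr_fun hab 1
  exact Units.ext (by simpa [Units.smul_def] using this)

/-- The diagonal representation of `(kˣ) ^ r`. -/
theorem exists_diagonal (k : Type*) [Field k] (r : ℕ) :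
    ∃ ρ : (Fin r → kˣ) →* ((Fin r → k) ≃ₗ[k] (Fin r → k)), Function.Injective ρ :=
  ⟨(Wreath.toLinear (DistribMulAction.toModuleAut k k) (Fin r)).comp SemidirectProduct.inl,
    (Wreath.toLinear_injective (toModuleAut_units_injective k k) _).comp
      SemidirectProduct.inl_injective⟩

end Linear

/-! ### Generators of `ℓ`-subgroups of `GL_d(𝔽_p)`: upper bounds -/

section Upper

variable {p : ℕ} [Fact p.Prime] {ℓ : ℕ} [Fact ℓ.Prime]

theorem dvd_pow_sub_one_iff (j : ℕ) : ℓ ∣ p ^ j - 1 ↔ orderOf (p : ZMod ℓ) ∣ j := by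
  have hp : p.Prime := Fact.out
  rw [orderOf_dvd_iff_pow_eq_one, ← ZMod.natCast_eq_zero_iff,
    Nat.cast_sub (Nat.one_le_pow _ _ hp.pos), sub_eq_zero]
  push_cast
  rfl

theorem orderOf_natCast_pos (hℓp : ℓ ≠ p) : 0 < orderOf (p : ZMod ℓ) := by
  have hp : p.Prime := Fact.out
  have hℓ : ℓ.Prime := Fact.out
  have h0 : (p : ZMod ℓ) ≠ 0 := fun h =>
    hℓp ((Nat.prime_dvd_prime_iff_eq hℓ hp).mp ((ZMod.natCast_eq_zero_iff _ _).mp h))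
  refine orderOf_pos_iff.mpr (isOfFinOrder_iff_pow_eq_one.mpr ⟨ℓ - 1, ?_, ?_⟩)
  · have := hℓ.two_le
    omega
  · exact ZMod.pow_card_sub_one_eq_one h0

theorem m_eq_orderOf (hℓp : ℓ ≠ p) : m p ℓ = orderOf (p : ZMod ℓ) := by
  have h : ∀ n, n ∈ {n : ℕ | 0 < n ∧ ℓ ∣ p ^ n - 1} ↔ 0 < n ∧ orderOf (p : ZMod ℓ) ∣ n := fun n =>
    and_congr_right fun _ => dvd_pow_sub_one_iff n
  refine le_antisymm (Nat.sInf_le ((h _).mpr ⟨orderOf_natCast_pos hℓp, dvd_rfl⟩)) ?_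
  have := (h _).mp (Nat.sInf_mem ⟨_, (h _).mpr ⟨orderOf_natCast_pos hℓp, dvd_rfl⟩⟩)
  exact Nat.le_of_dvd this.1 this.2

theorem card_units_galoisField {m : ℕ} (hm : m ≠ 0) :
    Nat.card (GaloisField p m)ˣ = p ^ m - 1 := by
  rw [Nat.card_units, GaloisField.card p m hm]

/-- Under the hypotheses of `padicValNat_card_GL_eq` with `c = 0`, every `ℓ`-subgroup of
`GL_d(𝔽_p)` is isomorphic to a group of monomial matrices over the field of `p ^ m` elements. -/
theorem exists_subgroup_wreath (hℓp : ℓ ≠ p) {m : ℕ} (hm : m ≠ 0)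
    (hc : ∀ j, ¬ m ∣ j → ¬ ℓ ∣ p ^ j - 1)
    (hl : ∀ t ≠ 0, padicValNat ℓ ((p ^ m) ^ t - 1) = padicValNat ℓ (p ^ m - 1) + padicValNat ℓ t)
    (d : ℕ) (H : Subgroup (Matrix.GeneralLinearGroup (Fin d) (ZMod p))) (hH : IsPGroup ℓ H) :
    ∃ H' : Subgroup (Wreath (GaloisField p m)ˣ (Fin (d / m))), Nonempty (H' ≃* H) := by
  have hp : p.Prime := Fact.out
  obtain ⟨φ, hφ⟩ := Wreath.exists_hom_GL (k := ZMod p)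
    (DistribMulAction.toModuleAut (ZMod p) (GaloisField p m) (S := (GaloisField p m)ˣ))
    (toModuleAut_units_injective (ZMod p) (GaloisField p m))
    (1 : Unit →* ((Fin (d % m) → ZMod p) ≃ₗ[ZMod p] (Fin (d % m) → ZMod p)))
    (Function.injective_of_subsingleton _) (d / m) (d := d) (by
      rw [GaloisField.finrank p hm, Module.finrank_fin_fun, mul_comm, Nat.div_add_mod])
  have hψ : Function.Injective
      (φ.comp (MonoidHom.inl (Wreath (GaloisField p m)ˣ (Fin (d / m))) Unit)) :=
    hφ.comp fun a b h => congrArg Prod.fst h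
  refine exists_subgroup_mulEquiv _ hψ (not_dvd_index_range _ hψ ?_) H hH
  have hq : p ^ m - 1 ≠ 0 := by
    have := Nat.one_lt_pow hm hp.one_lt
    omega
  rw [padicValNat_card_GL_eq hℓp (c := 0)
    (fun j hj => padicValNat.eq_zero_of_not_dvd (hc j hj)) hl, Wreath.card,
    card_units_galoisField hm, Nat.card_eq_fintype_card, Fintype.card_fin,
    padicValNat.mul (pow_ne_zero _ hq) (Nat.factorial_ne_zero _), padicValNat.pow]
  simp

theorem genLE_GL_of_odd (hℓp : ℓ ≠ p) (hℓ : Odd ℓ) (d : ℕ)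
    (H : Subgroup (Matrix.GeneralLinearGroup (Fin d) (ZMod p))) (hH : IsPGroup ℓ H) :
    GenLE (d / m p ℓ) H := by
  have hp : p.Prime := Fact.out
  have hm : m p ℓ ≠ 0 := by
    rw [m_eq_orderOf hℓp]
    exact (orderOf_natCast_pos hℓp).ne'
  have hd : ∀ j, ℓ ∣ p ^ j - 1 ↔ m p ℓ ∣ j := fun j => by
    rw [m_eq_orderOf hℓp, dvd_pow_sub_one_iff]
  obtain ⟨H', ⟨e⟩⟩ := exists_subgroup_wreath hℓp hm (fun j hj => (hd j).not.mpr hj)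
    (fun t ht => padicValNat_pow_sub_one_of_odd hℓ (Nat.one_lt_pow hm hp.one_lt)
      ((hd _).mpr dvd_rfl) ht) d H hH
  have h3 : 3 ≤ ℓ := by
    have := (Fact.out : ℓ.Prime).two_le
    obtain ⟨a, ha⟩ := hℓ
    omega
  have := Wreath.genLE_of_isCyclic_of_three_le h3 _ H' (hH.of_equiv e.symm)
  rw [Nat.card_eq_fintype_card, Fintype.card_fin] at this
  exact this.of_mulEquiv e

theorem genLE_GL_two_of_one_mod_four (hp4 : p % 4 = 1) (d : ℕ)
    (H : Subgroup (Matrix.GeneralLinearGroup (Fin d) (ZMod p))) (hH : IsPGroup 2 H) :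
    GenLE (d / 2 + d) H := by
  have hp : p.Prime := Fact.out
  obtain ⟨H', ⟨e⟩⟩ := exists_subgroup_wreath (ℓ := 2) (by omega) one_ne_zero
    (fun j hj => absurd (one_dvd j) hj)
    (fun t ht => by
      rw [pow_one]
      exact padicValNat_two_pow_sub_one hp.one_lt (by omega) ht) d H hH
  have := Wreath.genLE_of_isCyclic _ H' (hH.of_equiv e.symm)
  rw [Nat.card_eq_fintype_card, Fintype.card_fin] at this
  exact (this.of_mulEquiv e).mono (by simp)

theorem genLE_prod_pi {W K : Type*} [Group W] [Group K] [IsCyclic K] {n r : ℕ}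
    (H : Subgroup (W × (Fin r → K)))
    (hW : GenLE n (H.map (MonoidHom.fst W (Fin r → K)))) : GenLE (n + r) H := by
  let f : H →* W := (MonoidHom.fst W (Fin r → K)).comp H.subtype
  have hf : f.range = H.map (MonoidHom.fst W (Fin r → K)) := by
    rw [MonoidHom.range_comp, Subgroup.range_subtype]
  refine GenLE.of_range_of_ker f (hf ▸ hW) ?_
  refine GenLE.of_separating_fin r (fun i => (Pi.evalMonoidHom (fun _ => K) i).comp
    ((MonoidHom.snd W (Fin r → K)).comp (H.subtype.comp f.ker.subtype))) fun a ha => ?_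
  exact Subtype.ext (Subtype.ext (Prod.ext a.2 (funext ha)))

/-- The group of semilinear permutations of an extension field that are products of a
multiplication by a unit and an automorphism. -/
abbrev SemilinearUnits (k E : Type*) [Field k] [Field E] [Algebra k E] : Type _ :=
  Eˣ ⋊[MulDistribMulAction.toMulAut (E ≃ₐ[k] E) Eˣ] (E ≃ₐ[k] E)

theorem exists_semilinearUnits_hom (k E : Type*) [Field k] [Field E] [Algebra k E] :
    ∃ ρ : SemilinearUnits k E →* (E ≃ₗ[k] E), Function.Injective ρ := by
  let ρ : SemilinearUnits k E →* (E ≃ₗ[k] E) :=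
    SemidirectProduct.lift (DistribMulAction.toModuleAut k E (S := Eˣ))
      (DistribMulAction.toModuleAut k E (S := E ≃ₐ[k] E)) fun σ => by
        ext u x
        simp [Units.smul_def]
  refine ⟨ρ, (injective_iff_map_eq_one ρ).mpr fun a ha => ?_⟩
  have h : ∀ x, (a.left : E) * a.right x = x := fun x => LinearEquiv.congr_fun ha x
  have hl : a.left = 1 := Units.ext (by simpa using h 1)
  refine SemidirectProduct.ext hl (AlgEquiv.ext fun x => ?_)
  simpa [hl] using h x

/-- For `p ≡ 3 (mod 4)` the group `(Eˣ ⋊ Gal(E / 𝔽_p)) ≀ Sym(⌊d / 2⌋)`, where `E` is the field of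
`p ^ 2` elements, times `𝔽_pˣ` if `d` is odd, contains a copy of every `2`-subgroup of
`GL_d(𝔽_p)`. -/
theorem genLE_GL_two_of_three_mod_four (hp4 : p % 4 = 3) (d : ℕ)
    (H : Subgroup (Matrix.GeneralLinearGroup (Fin d) (ZMod p))) (hH : IsPGroup 2 H) :
    GenLE d H := by
  have hp : p.Prime := Fact.out
  let E := GaloisField p 2
  have hfr : Module.finrank (ZMod p) E = 2 := GaloisField.finrank p two_ne_zero
  have hgal : Nat.card (E ≃ₐ[ZMod p] E) = 2 := by
    rw [IsGalois.card_aut_eq_finrank, hfr]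
  obtain ⟨ρ, hρ⟩ := exists_semilinearUnits_hom (ZMod p) E
  obtain ⟨ρ', hρ'⟩ := exists_diagonal (ZMod p) (d % 2)
  obtain ⟨φ, hφ⟩ := Wreath.exists_hom_GL ρ hρ ρ' hρ' (d / 2) (d := d) (by
    rw [hfr, Module.finrank_fin_fun, mul_comm, Nat.div_add_mod])
  have hsq : p ^ 2 % 8 = 1 := by
    have h8 : p % 8 = 3 ∨ p % 8 = 7 := by omega
    rcases h8 with h8 | h8 <;> rw [Nat.pow_mod, h8]
  have hone : 1 < p ^ 2 := Nat.one_lt_pow two_ne_zero hp.one_lt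
  have hi : ¬ 2 ∣ φ.range.index := by
    refine not_dvd_index_range φ hφ ?_
    have h1 : padicValNat 2 (p - 1) = 1 := by
      simpa using padicValNat_two_odd_pow_sub_one hp4 odd_one
    have hE : Nat.card (SemilinearUnits (ZMod p) E) = (p ^ 2 - 1) * 2 := by
      rw [SemidirectProduct.card, hgal, card_units_galoisField two_ne_zero]
    have hp1 := hp.one_lt
    have hpu : Nat.card (Fin (d % 2) → (ZMod p)ˣ) = (p - 1) ^ (d % 2) := by
      rw [Nat.card_fun, Nat.card_units, Nat.card_zmod, Nat.card_eq_fintype_card, Fintype.card_fin]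
    rw [padicValNat_card_GL_eq (ℓ := 2) (by omega) (m := 2) (c := 1)
      (fun j hj => padicValNat_two_odd_pow_sub_one hp4
        (Nat.not_even_iff_odd.mp (even_iff_two_dvd.not.mpr hj)))
      (fun t ht => padicValNat_two_pow_sub_one hone (by omega) ht), Nat.card_prod, Wreath.card,
      hE, hpu, Nat.card_eq_fintype_card, Fintype.card_fin,
      padicValNat.mul (mul_ne_zero (pow_ne_zero _ (by omega)) (Nat.factorial_ne_zero _))
        (pow_ne_zero _ (by omega)),
      padicValNat.mul (pow_ne_zero _ (by omega)) (Nat.factorial_ne_zero _), padicValNat.pow,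
      padicValNat.pow, padicValNat.mul (by omega) two_ne_zero, padicValNat.self (by norm_num), h1]
    have : d - d / 2 = d / 2 + d % 2 := by omega
    rw [this]
    ring
  obtain ⟨H', ⟨e⟩⟩ := exists_subgroup_mulEquiv φ hφ hi H hH
  have : IsCyclic (E ≃ₐ[ZMod p] E) := isCyclic_of_prime_card hgal
  let _ : CommGroup (E ≃ₐ[ZMod p] E) := IsCyclic.commGroup
  let f : SemilinearUnits (ZMod p) E →* (E ≃ₐ[ZMod p] E) := SemidirectProduct.rightHom
  have : IsCyclic f.ker := by
    -- the kernel is a copy of the cyclic group `Eˣ`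
    have h : f.ker = (SemidirectProduct.inl : Eˣ →* SemilinearUnits (ZMod p) E).range :=
      SemidirectProduct.range_inl_eq_ker_rightHom.symm
    rw [h]
    exact isCyclic_of_surjective _
      (SemidirectProduct.inl : Eˣ →* SemilinearUnits (ZMod p) E).rangeRestrict_surjective
  have hpH' : IsPGroup 2 H' := hH.of_equiv e.symm
  have hW := Wreath.genLE_of_isCyclic_ker hgal f (Fin (d / 2)) _ (hpH'.map (MonoidHom.fst _ _))
  refine ((genLE_prod_pi H' hW).of_mulEquiv e).mono ?_
  rw [Nat.card_eq_fintype_card, Fintype.card_fin]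
  omega

end Upper

/-! ### Generators of `ℓ`-subgroups of `GL_d(𝔽_p)`: lower bounds -/

/-- The group `A` has an elementary abelian quotient of order `ℓ ^ r`. -/
def HasElementaryQuotient (ℓ r : ℕ) (A : Type*) [Group A] : Prop :=
  ∃ (Q : Type) (_ : CommGroup Q), (∀ q : Q, q ^ ℓ = 1) ∧ Nat.card Q = ℓ ^ r ∧
    ∃ f : A →* Q, Function.Surjective f

theorem card_closure_le {ℓ : ℕ} (hℓ : 0 < ℓ) {Q : Type*} [CommGroup Q] (hQ : ∀ q : Q, q ^ ℓ = 1)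
    (S : Finset Q) : Nat.card (Subgroup.closure (S : Set Q)) ≤ ℓ ^ S.card := by
  classical
  induction S using Finset.induction_on with
  | empty => simp
  | insert a S ha ih =>
    rw [Finset.coe_insert, Set.insert_eq, Subgroup.closure_union, ← Subgroup.zpowers_eq_closure,
      Finset.card_insert_of_notMem ha, pow_succ']
    have h1 : Nat.card (Subgroup.zpowers a) ≤ ℓ := by
      rw [Nat.card_zpowers]
      exact Nat.le_of_dvd hℓ (orderOf_dvd_of_pow_eq_one (hQ a))
    refine le_trans ?_ (Nat.mul_le_mul h1 ih)
    have h2 : Nat.card ((Subgroup.zpowers a ⊔ Subgroup.closure (S : Set Q) : Subgroup Q) : Set Q) ≤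
        Nat.card (Subgroup.zpowers a : Set Q) *
          Nat.card (Subgroup.closure (S : Set Q) : Set Q) := by
      rw [Subgroup.mul_normal]
      exact Set.natCard_mul_le
    exact h2

namespace HasElementaryQuotient

variable {ℓ r s : ℕ} {A B : Type*} [Group A] [Group B]

theorem le_encard [Fact ℓ.Prime] (h : HasElementaryQuotient ℓ r A) (T : Set A)
    (hT : Subgroup.closure T = ⊤) : (r : ℕ∞) ≤ T.encard := by
  classical
  have hℓ : ℓ.Prime := Fact.out
  obtain ⟨Q, _, hQ, hc, f, hf⟩ := h
  rcases T.finite_or_infinite with hfin | hinf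
  swap
  · rw [hinf.encard_eq]
    exact le_top
  lift T to Finset A using hfin
  have hcl : Subgroup.closure ((T.image f : Finset Q) : Set Q) = ⊤ := by
    rw [Finset.coe_image, ← MonoidHom.map_closure, hT, ← MonoidHom.range_eq_map,
      MonoidHom.range_eq_top.mpr hf]
  have h1 := card_closure_le hℓ.pos hQ (T.image f)
  rw [hcl, Subgroup.card_top, hc, Nat.pow_le_pow_iff_right hℓ.one_lt] at h1
  rw [Set.encard_coe_eq_coe_finsetCard]
  exact_mod_cast h1.trans Finset.card_image_le

theorem of_mulEquiv (h : HasElementaryQuotient ℓ r A) (e : A ≃* B) :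
    HasElementaryQuotient ℓ r B := by
  obtain ⟨Q, _, hQ, hc, f, hf⟩ := h
  exact ⟨Q, _, hQ, hc, f.comp e.symm.toMonoidHom, hf.comp e.symm.surjective⟩

theorem prod (hA : HasElementaryQuotient ℓ r A) (hB : HasElementaryQuotient ℓ s B) :
    HasElementaryQuotient ℓ (r + s) (A × B) := by
  obtain ⟨Q, _, hQ, hc, f, hf⟩ := hA
  obtain ⟨Q', _, hQ', hc', f', hf'⟩ := hB
  exact ⟨Q × Q', inferInstance, fun q => Prod.ext (hQ _) (hQ' _), by
    rw [Nat.card_prod, hc, hc', pow_add], f.prodMap f', hf.prodMap hf'⟩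

theorem pi (hA : HasElementaryQuotient ℓ r A) (n : ℕ) :
    HasElementaryQuotient ℓ (r * n) (Fin n → A) := by
  obtain ⟨Q, _, hQ, hc, f, hf⟩ := hA
  exact ⟨Fin n → Q, inferInstance, fun q => funext fun i => hQ _, by
    rw [Nat.card_fun, hc, pow_mul, Nat.card_eq_fintype_card, Fintype.card_fin], f.compLeft (Fin n),
    fun q => ⟨fun i => (hf (q i)).choose, funext fun i => (hf (q i)).choose_spec⟩⟩

theorem of_card {Q : Type} [CommGroup Q] (hQ : Nat.card Q = ℓ) : HasElementaryQuotient ℓ 1 Q :=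
  ⟨Q, inferInstance, fun _ => hQ ▸ pow_card_eq_one', by rw [hQ, pow_one], MonoidHom.id _,
    Function.surjective_id⟩

end HasElementaryQuotient

theorem isPGroup_pi {ℓ n : ℕ} {A : Type*} [Group A] {k : ℕ} (h : ∀ a : A, a ^ ℓ ^ k = 1) :
    IsPGroup ℓ (Fin n → A) := fun g => ⟨k, funext fun i => h (g i)⟩

section Lower

variable {p : ℕ} [Fact p.Prime]

/-- The diagonal matrices over the field of `p ^ m` elements whose entries are `ℓ`-th roots of
unity. -/
theorem exists_elementary_hom_GL {ℓ : ℕ} [Fact ℓ.Prime] {m : ℕ} (hm : m ≠ 0) (h : ℓ ∣ p ^ m - 1)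
    (d : ℕ) : ∃ (A : Type) (_ : Group A)
      (φ : A →* Matrix.GeneralLinearGroup (Fin d) (ZMod p)),
      Function.Injective φ ∧ IsPGroup ℓ A ∧ HasElementaryQuotient ℓ (d / m) A := by
  let E := GaloisField p m
  obtain ⟨g, hg⟩ : ∃ g : Eˣ, orderOf g = ℓ :=
    exists_prime_orderOf_dvd_card' ℓ (by rwa [card_units_galoisField hm])
  have hc : Nat.card (Subgroup.zpowers g) = ℓ := by rw [Nat.card_zpowers, hg]
  let ρ := (DistribMulAction.toModuleAut (ZMod p) E (S := Eˣ)).comp (Subgroup.zpowers g).subtype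
  have hρ : Function.Injective ρ :=
    (toModuleAut_units_injective (ZMod p) E).comp Subtype.val_injective
  obtain ⟨φ, hφ⟩ := Wreath.exists_hom_GL (k := ZMod p) ρ hρ
    (1 : Unit →* ((Fin (d % m) → ZMod p) ≃ₗ[ZMod p] (Fin (d % m) → ZMod p)))
    (Function.injective_of_subsingleton _) (d / m) (d := d) (by
      rw [GaloisField.finrank p hm, Module.finrank_fin_fun, mul_comm, Nat.div_add_mod])
  refine ⟨Fin (d / m) → Subgroup.zpowers g, inferInstance,
    (φ.comp (MonoidHom.inl _ Unit)).comp SemidirectProduct.inl,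
    (hφ.comp fun a b h => congrArg Prod.fst h).comp SemidirectProduct.inl_injective,
    isPGroup_pi (k := 1) fun a => ?_, ?_⟩
  · rw [pow_one]
    exact hc ▸ pow_card_eq_one'
  · simpa using (HasElementaryQuotient.of_card hc).pi (d / m)

/-- The group of monomial `2 × 2` matrices whose nonzero entries have squares `±1` and ratio `±1`.
If `F` contains a primitive fourth root of unity it is the central product of a cyclic group of
order `4` and a dihedral group of order `8`, which needs three generators. -/
def pauliGroup (F : Type*) [Field F] : Subgroup (Wreath Fˣ (Fin 2)) where
  carrier := {w | ∀ i j, w.left i ^ 2 ∈ Subgroup.zpowers (-1 : Fˣ) ∧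
    w.left i / w.left j ∈ Subgroup.zpowers (-1 : Fˣ)}
  one_mem' i j := by simp
  mul_mem' {v w} hv hw i j := by
    simp only [Wreath.mul_left_apply]
    refine ⟨?_, ?_⟩
    · rw [mul_pow]
      exact mul_mem (hv i i).1 (hw _ (v.right⁻¹ i)).1
    · rw [mul_div_mul_comm]
      exact mul_mem (hv i j).2 (hw _ _).2
  inv_mem' {w} hw i j := by
    have h : ∀ i, w⁻¹.left i = (w.left (w.right i))⁻¹ := fun i => by
      simp only [SemidirectProduct.inv_left, map_inv]
      rfl
    rw [h, h, inv_pow, inv_div_inv]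
    exact ⟨inv_mem (hw _ i).1, (hw _ _).2⟩

namespace pauliGroup

variable {F : Type*} [Field F]

theorem sq_eq_one_of_mem {a : Fˣ} (ha : a ∈ Subgroup.zpowers (-1 : Fˣ)) : a ^ 2 = 1 := by
  obtain ⟨k, rfl⟩ := ha
  simp only [← zpow_natCast, ← zpow_mul]
  rw [mul_comm, zpow_mul]
  simp

theorem pow_four_eq_one (w : pauliGroup F) : w ^ 2 ^ 2 = 1 := by
  have hr : ∀ σ : Equiv.Perm (Fin 2), σ * σ = 1 := by decide
  have hb : ∀ v : pauliGroup F, (v : Wreath Fˣ (Fin 2)).right = 1 →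
      (∀ i, (v : Wreath Fˣ (Fin 2)).left i ∈ Subgroup.zpowers (-1 : Fˣ)) → v * v = 1 := by
    intro v hv hl
    refine Subtype.ext (SemidirectProduct.ext (funext fun i => ?_) ?_)
    · rw [Subgroup.coe_mul, Wreath.mul_left_apply, hv]
      simpa [sq] using sq_eq_one_of_mem (hl i)
    · rw [Subgroup.coe_mul, Wreath.mul_right, hv]
      rfl
  have : w ^ 2 ^ 2 = (w * w) * (w * w) := by
    change w ^ (2 + 2) = _
    rw [pow_add, sq]
  rw [this]
  refine hb _ (hr _) fun i => ?_
  rw [Subgroup.coe_mul, Wreath.mul_left_apply]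
  have h := mul_mem (w.2 i i).1 (w.2 ((w : Wreath Fˣ (Fin 2)).right⁻¹ i) i).2
  convert h using 1
  rw [sq, mul_assoc, mul_div_cancel]

/-- The squares of the entries, the ratio of the two entries, and the sign of the underlying
permutation. -/
def toElementary (F : Type*) [Field F] :
    pauliGroup F →* Subgroup.zpowers (-1 : Fˣ) × Subgroup.zpowers (-1 : Fˣ) × ℤˣ where
  toFun w := (⟨_, (w.2 0 0).1⟩, ⟨_, (w.2 0 1).2⟩,
    Equiv.Perm.sign (w : Wreath Fˣ (Fin 2)).right)
  map_one' := by
    refine Prod.ext (Subtype.ext ?_) (Prod.ext (Subtype.ext ?_) ?_) <;> simp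
  map_mul' v w := by
    have h1 : ∀ i j, (w : Wreath Fˣ (Fin 2)).left i ^ 2 = (w : Wreath Fˣ (Fin 2)).left j ^ 2 :=
      fun i j => by
        rw [← div_eq_one, ← div_pow]
        exact sq_eq_one_of_mem (w.2 i j).2
    have h2 : ∀ σ : Equiv.Perm (Fin 2),
        (w : Wreath Fˣ (Fin 2)).left (σ 0) / (w : Wreath Fˣ (Fin 2)).left (σ 1) =
        (w : Wreath Fˣ (Fin 2)).left 0 / (w : Wreath Fˣ (Fin 2)).left 1 := by
      intro σ
      have hσ : ∀ σ : Equiv.Perm (Fin 2), σ 0 = 0 ∧ σ 1 = 1 ∨ σ 0 = 1 ∧ σ 1 = 0 := by decide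
      rcases hσ σ with ⟨h, h'⟩ | ⟨h, h'⟩
      · rw [h, h']
      · rw [h, h', ← inv_div, inv_eq_iff_mul_eq_one, ← sq]
        exact sq_eq_one_of_mem (w.2 0 1).2
    refine Prod.ext (Subtype.ext ?_) (Prod.ext (Subtype.ext ?_) ?_)
    · simp only [Subgroup.coe_mul, Wreath.mul_left_apply, mul_pow, Prod.fst_mul]
      rw [h1 _ 0]
    · simp only [Subgroup.coe_mul, Wreath.mul_left_apply, Prod.snd_mul, Prod.fst_mul]
      rw [mul_div_mul_comm, h2]
    · simp

theorem toElementary_surjective {F : Type*} [Field F] {i : Fˣ} (hi : i ^ 2 = -1) :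
    Function.Surjective (toElementary F) := by
  rintro ⟨⟨_, k, rfl⟩, ⟨_, l, rfl⟩, s⟩
  obtain ⟨σ, hσ⟩ := Equiv.Perm.sign_surjective (Fin 2) s
  have hm : ∀ k : ℤ, (-1 : Fˣ) ^ k ∈ Subgroup.zpowers (-1 : Fˣ) := fun k => ⟨k, rfl⟩
  have hk : (i ^ k) ^ 2 = (-1) ^ k := by
    rw [← zpow_natCast, ← zpow_mul, mul_comm, zpow_mul, zpow_natCast, hi]
  have hl : ((-1 : Fˣ) ^ l) ^ 2 = 1 := sq_eq_one_of_mem (hm l)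
  refine ⟨⟨⟨![i ^ k, i ^ k * (-1) ^ l], σ⟩, ?_⟩, ?_⟩
  · intro a b
    fin_cases a <;> fin_cases b <;>
      simp only [Fin.zero_eta, Fin.mk_one, Matrix.cons_val_zero, Matrix.cons_val_one, mul_pow, hk,
        hl, mul_one, div_self', div_mul_cancel_left, mul_div_cancel_left] <;>
      exact ⟨hm _, by first | exact one_mem _ | exact hm _ | exact inv_mem (hm _)⟩
  · refine Prod.ext (Subtype.ext hk) (Prod.ext (Subtype.ext ?_) hσ)
    change i ^ k / (i ^ k * (-1) ^ l) = (-1) ^ l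
    rw [div_mul_cancel_left, inv_eq_iff_mul_eq_one, ← sq, hl]

theorem hasElementaryQuotient {F : Type} [Field F] (h2 : (-1 : F) ≠ 1) {i : Fˣ} (hi : i ^ 2 = -1) :
    HasElementaryQuotient 2 3 (pauliGroup F) := by
  refine ⟨_, inferInstance, fun q => ?_, ?_, toElementary F, toElementary_surjective hi⟩
  · refine Prod.ext (Subtype.ext (sq_eq_one_of_mem q.1.2)) (Prod.ext
      (Subtype.ext (sq_eq_one_of_mem q.2.1.2)) (Int.units_sq _))
  · have h : Nat.card (Subgroup.zpowers (-1 : Fˣ)) = 2 := by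
      rw [Nat.card_zpowers]
      exact orderOf_eq_prime (by simp) fun h => h2 (congrArg Units.val h)
    rw [Nat.card_prod, Nat.card_prod, h, Nat.card_eq_fintype_card, Fintype.card_units_int]
    norm_num

end pauliGroup

/-- For `p ≡ 1 (mod 4)`, block diagonal matrices with blocks in `pauliGroup` give a `2`-subgroup of
`GL_d(𝔽_p)` that needs `3 ⌊d / 2⌋ + (d mod 2)` generators. -/
theorem exists_pauli_hom_GL (hp4 : p % 4 = 1) (d : ℕ) : ∃ (A : Type) (_ : Group A)
      (φ : A →* Matrix.GeneralLinearGroup (Fin d) (ZMod p)),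
      Function.Injective φ ∧ IsPGroup 2 A ∧ HasElementaryQuotient 2 (3 * (d / 2) + d % 2) A := by
  have hp : p.Prime := Fact.out
  obtain ⟨y, hy⟩ : IsSquare (-1 : ZMod p) := ZMod.exists_sq_eq_neg_one_iff.mpr (by omega)
  have hy0 : y ≠ 0 := by
    rintro rfl
    simp at hy
  let i : (ZMod p)ˣ := Units.mk0 y hy0
  have hi : i ^ 2 = -1 := Units.ext (by simp [i, sq, hy])
  have h2 : (-1 : ZMod p) ≠ 1 := by
    have : Fact (2 < p) := ⟨by have := hp.one_lt; omega⟩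
    exact ZMod.neg_one_ne_one
  let ρ := (Wreath.toLinear (DistribMulAction.toModuleAut (ZMod p) (ZMod p)
    (S := (ZMod p)ˣ)) (Fin 2)).comp (pauliGroup (ZMod p)).subtype
  have hρ : Function.Injective ρ :=
    (Wreath.toLinear_injective (toModuleAut_units_injective (ZMod p) (ZMod p)) _).comp
      Subtype.val_injective
  obtain ⟨ρ', hρ'⟩ := exists_diagonal (ZMod p) (d % 2)
  obtain ⟨φ, hφ⟩ := Wreath.exists_hom_GL ρ hρ ρ' hρ' (d / 2) (d := d) (by
    rw [Module.finrank_fin_fun, Module.finrank_fin_fun, mul_comm, Nat.div_add_mod])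
  let C := Subgroup.zpowers (-1 : (ZMod p)ˣ)
  have hC : Nat.card C = 2 := by
    rw [Nat.card_zpowers]
    exact orderOf_eq_prime (by simp) fun h => h2 (congrArg Units.val h)
  refine ⟨(Fin (d / 2) → pauliGroup (ZMod p)) × (Fin (d % 2) → C), inferInstance,
    φ.comp (SemidirectProduct.inl.prodMap (C.subtype.compLeft (Fin (d % 2)))),
    hφ.comp (SemidirectProduct.inl_injective.prodMap fun a b h => funext fun j =>
      Subtype.ext (congrFun h j)), fun a => ⟨2, ?_⟩, ?_⟩
  · refine Prod.ext (funext fun j => pauliGroup.pow_four_eq_one _) (funext fun j => ?_)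
    change a.2 j ^ (2 * 2) = 1
    rw [pow_mul, show a.2 j ^ 2 = 1 from Subtype.ext (pauliGroup.sq_eq_one_of_mem (a.2 j).2),
      one_pow]
  · simpa using ((pauliGroup.hasElementaryQuotient h2 hi).pi (d / 2)).prod
      ((HasElementaryQuotient.of_card hC).pi (d % 2))

end Lower

/-! ### Sylow pro-`ℓ` subgroups of virtually pro-`p` groups -/

section FiniteRank

variable {S : Type*} [Group S] [TopologicalSpace S] [IsTopologicalGroup S]

theorem minGenerators_le_of_genLE {r : ℕ} (h : GenLE r S) : minGenerators S ≤ r := by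
  obtain ⟨T, hT, hc⟩ := h
  refine (iInf₂_le (T : Set S) ?_).trans ?_
  · exact top_unique (hc ▸ Subgroup.le_topologicalClosure _)
  · rw [Set.encard_coe_eq_coe_finsetCard]
    exact_mod_cast hT

variable [DiscreteTopology S]

theorem le_minGenerators {ℓ r : ℕ} [Fact ℓ.Prime] (h : HasElementaryQuotient ℓ r S) :
    (r : ℕ∞) ≤ minGenerators S := by
  refine le_iInf₂ fun T hT => h.le_encard T ?_
  rw [← hT]
  refine SetLike.coe_injective ?_
  rw [Subgroup.topologicalClosure_coe, (isClosed_discrete _).closure_eq]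

theorem rank_eq_of_discrete {ℓ r : ℕ} [Fact ℓ.Prime] (hu : ∀ H : Subgroup S, GenLE r H)
    (hl : ∃ H : Subgroup S, HasElementaryQuotient ℓ r H) : rank S = r := by
  refine le_antisymm (iSup₂_le fun H _ => minGenerators_le_of_genLE (hu H)) ?_
  obtain ⟨H, hH⟩ := hl
  exact (le_minGenerators hH).trans (le_iSup₂_of_le H (isClosed_discrete _) le_rfl)

end FiniteRank

/-- A finite quotient `π : G → Q` of a compact group whose kernel is filtered by open normal
subgroups `K n` with trivial intersection, such that the kernel modulo `K n` has exponent dividing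
`p ^ n`. -/
structure PFiltration {G Q : Type*} [Group G] [TopologicalSpace G] [Group Q] (p : ℕ)
    (π : G →* Q) (K : ℕ → Subgroup G) : Prop where
  surjective : Function.Surjective π
  normal : ∀ n, (K n).Normal
  isOpen : ∀ n, IsOpen (K n : Set G)
  zero : K 0 = π.ker
  antitone : Antitone K
  eq_one : ∀ x, (∀ n, x ∈ K n) → x = 1
  pow_mem : ∀ x ∈ π.ker, ∀ n, x ^ p ^ n ∈ K n

namespace PFiltration

variable {G Q : Type*} [Group G] [TopologicalSpace G] [Group Q]
  {p ℓ : ℕ} {π : G →* Q} {K : ℕ → Subgroup G}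

theorem le_ker (h : PFiltration p π K) (n : ℕ) : K n ≤ π.ker :=
  (h.antitone (Nat.zero_le n)).trans h.zero.le

theorem mem_of_pow_mem (h : PFiltration p π K) (hpℓ : Nat.Coprime p ℓ) {x : G} (hx : x ∈ π.ker)
    {n k : ℕ} (hk : x ^ ℓ ^ k ∈ K n) : x ∈ K n := by
  have := h.normal n
  rw [← QuotientGroup.eq_one_iff] at hk ⊢
  have h1 := (QuotientGroup.eq_one_iff (N := K n) _).mpr (h.pow_mem x hx n)
  rw [QuotientGroup.mk_pow] at hk h1
  rw [← orderOf_eq_one_iff]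
  exact Nat.eq_one_of_dvd_coprimes (Nat.Coprime.pow n k hpℓ) (orderOf_dvd_of_pow_eq_one h1)
    (orderOf_dvd_of_pow_eq_one hk)

variable [IsTopologicalGroup G] [CompactSpace G]

/-- Sylow's theorem in `G / K n` provides, for each `n`, a lift of a Sylow `ℓ`-subgroup of `Q` to
`G` that is multiplicative modulo `K n`. -/
theorem exists_lift_mod [Fact ℓ.Prime] (h : PFiltration p π K)
    (hpℓ : Nat.Coprime p ℓ) (P : Sylow ℓ Q) (n : ℕ) :
    ∃ f : P → G, (∀ x, π (f x) = x) ∧ ∀ x y, (f (x * y))⁻¹ * (f x * f y) ∈ K n := by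
  have := h.normal n
  have : Finite (G ⧸ K n) := Subgroup.quotient_finite_of_isOpen _ (h.isOpen n)
  let π' : G ⧸ K n →* Q := QuotientGroup.lift (K n) π (h.le_ker n)
  have hπ' : Function.Surjective π' := fun q => by
    obtain ⟨g, rfl⟩ := h.surjective q
    exact ⟨g, rfl⟩
  obtain ⟨P', hP'⟩ := Sylow.mapSurjective_surjective hπ' ℓ P
  have hmap : (P' : Subgroup (G ⧸ K n)).map π' = P :=
    congrArg (fun S : Sylow ℓ Q => (S : Subgroup Q)) hP'
  -- the kernel of `G / K n → Q` is a `p`-group, so it meets `P'` trivially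
  have hinj : ∀ y ∈ P', π' y = 1 → y = 1 := by
    intro y hy hy1
    obtain ⟨g, rfl⟩ := QuotientGroup.mk_surjective y
    obtain ⟨k, hk⟩ := P'.isPGroup' ⟨_, hy⟩
    refine (QuotientGroup.eq_one_iff g).mpr (h.mem_of_pow_mem hpℓ (k := k) hy1 ?_)
    rw [← QuotientGroup.eq_one_iff, QuotientGroup.mk_pow]
    exact congrArg Subtype.val hk
  have hex : ∀ x : P, ∃ y ∈ P', π' y = x := fun x => by
    have hx : (x : Q) ∈ (P' : Subgroup (G ⧸ K n)).map π' := hmap ▸ x.2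
    exact hx
  choose y hyP hy using hex
  refine ⟨fun x => (y x).out, fun x => ?_, fun a b => ?_⟩
  · conv_rhs => rw [← hy x, ← QuotientGroup.out_eq' (y x)]
    rfl
  · rw [← QuotientGroup.eq_one_iff]
    have h1 : (y (a * b))⁻¹ * (y a * y b) = 1 :=
      hinj _ (P'.mul_mem (P'.inv_mem (hyP _)) (P'.mul_mem (hyP _) (hyP _))) (by
        rw [map_mul, map_inv, map_mul, hy, hy, hy, Subgroup.coe_mul, inv_mul_cancel])
    simpa using h1

/-- A Sylow `ℓ`-subgroup of `Q` lifts to `G`: the lifts modulo the `K n` form a decreasing sequence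
of nonempty compact sets of functions. -/
theorem exists_lift [Fact ℓ.Prime] (h : PFiltration p π K)
    (hpℓ : Nat.Coprime p ℓ) (P : Sylow ℓ Q) : ∃ f : P →* G, ∀ x, π (f x) = x := by
  let X : ℕ → Set (P → G) := fun n =>
    {f | (∀ x, π (f x) = x) ∧ ∀ x y, (f (x * y))⁻¹ * (f x * f y) ∈ K n}
  have hclosed : ∀ n, IsClosed (X n) := by
    intro n
    have hK : ∀ n, IsClosed (K n : Set G) := fun n =>
      Subgroup.isClosed_of_isOpen _ (h.isOpen n)
    have hX : X n = (⋂ x : P, {f : P → G | π (f x) = x}) ∩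
        ⋂ x : P, ⋂ y : P, {f : P → G | (f (x * y))⁻¹ * (f x * f y) ∈ K n} := by
      ext f
      simp [X]
    rw [hX]
    refine IsClosed.inter ?_ ?_
    · refine isClosed_iInter fun x => ?_
      obtain ⟨g, hg⟩ := h.surjective x
      have : {f : P → G | π (f x) = x} = (fun f => g⁻¹ * f x) ⁻¹' (K 0 : Set G) := by
        ext f
        rw [Set.mem_ofPred_eq, Set.mem_preimage, h.zero, SetLike.mem_coe, MonoidHom.mem_ker,
          map_mul, map_inv, hg, inv_mul_eq_one, eq_comm]
      rw [this]
      exact (hK 0).preimage (by fun_prop)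
    · refine isClosed_iInter fun x => isClosed_iInter fun y => ?_
      exact (hK n).preimage (f := fun f : P → G => (f (x * y))⁻¹ * (f x * f y)) (by fun_prop)
  obtain ⟨f, hf⟩ := IsCompact.nonempty_iInter_of_sequence_nonempty_isCompact_isClosed X
    (fun n f hf => ⟨hf.1, fun x y => h.antitone n.le_succ (hf.2 x y)⟩)
    (fun n => h.exists_lift_mod hpℓ P n) (hclosed 0).isCompact hclosed
  rw [Set.mem_iInter] at hf
  refine ⟨MonoidHom.mk' f fun x y => ?_, (hf 0).1⟩
  exact inv_mul_eq_one.mp (h.eq_one _ fun n => (hf n).2 x y)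

theorem exists_isSylowPro [T2Space G] [Finite Q] [Fact p.Prime] [Fact ℓ.Prime]
    (h : PFiltration p π K) (hpℓ : Nat.Coprime p ℓ) : ∃ S : Subgroup G, IsSylowPro ℓ S := by
  have hℓ : ℓ.Prime := Fact.out
  let P : Sylow ℓ Q := default
  obtain ⟨f, hf⟩ := h.exists_lift hpℓ P
  have hfi : Function.Injective f := fun x y hxy => Subtype.ext (by rw [← hf x, ← hf y, hxy])
  have hfin : Finite f.range := (MonoidHom.ofInjective hfi).toEquiv.finite_iff.mp inferInstance
  have hcard : Nat.card f.range = Nat.card P :=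
    (Nat.card_congr (MonoidHom.ofInjective hfi).toEquiv).symm
  refine ⟨f.range, (Set.toFinite (f.range : Set G)).isClosed,
    ⟨inferInstance, inferInstance, fun N _ _ => ?_⟩, fun U hU hSU => ?_⟩
  · obtain ⟨k, hk⟩ := IsPGroup.iff_card.mp P.isPGroup'
    have hd := N.index_dvd_card
    rw [hcard] at hd
    obtain ⟨j, -, hj⟩ := (Nat.dvd_prime_pow hℓ).mp (hk ▸ hd)
    exact ⟨j, hj⟩
  -- `U` contains some `K n`, and modulo `K n` the order of `G` is `|Q|` times a power of `p`
  obtain ⟨n, hn⟩ : ∃ n, (K n : Set G) ⊆ U := by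
    refine exists_subset_nhds_of_isCompact' (V := fun n => (K n : Set G))
      (directed_of_isDirected_le fun a b hab => h.antitone hab)
      (fun n => (Subgroup.isClosed_of_isOpen _ (h.isOpen n)).isCompact)
      (fun n => Subgroup.isClosed_of_isOpen _ (h.isOpen n)) fun x hx => ?_
    rw [h.eq_one x (Set.mem_iInter.mp hx)]
    exact hU.mem_nhds U.one_mem
  have := h.normal n
  have : Finite (G ⧸ K n) := Subgroup.quotient_finite_of_isOpen _ (h.isOpen n)
  let q := QuotientGroup.mk' (K n)
  have hq : Function.Surjective q := QuotientGroup.mk'_surjective _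
  let π' : G ⧸ K n →* Q := QuotientGroup.lift (K n) π (h.le_ker n)
  have hπ' : Function.Surjective π' := fun x => by
    obtain ⟨g, rfl⟩ := h.surjective x
    exact ⟨g, rfl⟩
  have hker : IsPGroup p π'.ker := by
    rintro ⟨y, hy⟩
    obtain ⟨g, rfl⟩ := QuotientGroup.mk_surjective y
    refine ⟨n, Subtype.ext ?_⟩
    exact (QuotientGroup.eq_one_iff _).mpr (h.pow_mem g hy n)
  obtain ⟨j, hj⟩ := IsPGroup.iff_card.mp hker
  have hS : Nat.card (f.range.map q) = Nat.card P := by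
    have hqf : Function.Injective (q.comp f) := fun x y hxy => Subtype.ext (by
      rw [← hf x, ← hf y]
      exact congrArg π' hxy)
    have : f.range.map q = (q.comp f).range := by rw [MonoidHom.range_comp]
    rw [this]
    exact (Nat.card_congr (MonoidHom.ofInjective hqf).toEquiv).symm
  have hidx : (f.range.map q).index = (P : Subgroup Q).index * p ^ j := by
    have h1 := Subgroup.card_mul_index (f.range.map q)
    have h2 := Subgroup.card_mul_index (P : Subgroup Q)
    have h3 := Subgroup.card_mul_index π'.ker
    rw [Subgroup.index_ker, MonoidHom.range_eq_top.mpr hπ', Subgroup.card_top, hj] at h3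
    rw [hS, ← h3, ← h2] at h1
    have h0 : 0 < Nat.card P := Nat.card_pos
    refine Nat.eq_of_mul_eq_mul_left h0 (h1.trans ?_)
    ring
  have hU' : U.index = (U.map q).index := by
    rw [← Subgroup.index_comap_of_surjective (U.map q) hq, Subgroup.comap_map_eq,
      QuotientGroup.ker_mk', sup_eq_left.mpr (SetLike.coe_subset_coe.mp hn)]
  intro hd
  have hd' := (hU' ▸ hd).trans (Subgroup.index_dvd_of_le (Subgroup.map_mono hSU))
  rw [hidx] at hd'
  rcases hℓ.dvd_mul.mp hd' with hd' | hd'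
  · exact P.not_dvd_index hd'
  · have := hℓ.dvd_of_dvd_pow hd'
    exact hℓ.one_lt.ne' (Nat.eq_one_of_dvd_coprimes hpℓ this dvd_rfl)

/-- The `ℓ`-rank of `G` is the largest number of generators of an `ℓ`-subgroup of `Q`, because
`π` maps Sylow pro-`ℓ` subgroups of `G` isomorphically onto Sylow `ℓ`-subgroups of `Q`. -/
theorem ellRankEq [T2Space G] [Finite Q] [Fact p.Prime] [Fact ℓ.Prime]
    (h : PFiltration p π K) (hpℓ : Nat.Coprime p ℓ) {r : ℕ}
    (hu : ∀ H : Subgroup Q, IsPGroup ℓ H → GenLE r H)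
    (hl : ∃ (A : Type) (_ : Group A) (φ : A →* Q),
      Function.Injective φ ∧ IsPGroup ℓ A ∧ HasElementaryQuotient ℓ r A) :
    EllRankEq ℓ G r := by
  refine ⟨h.exists_isSylowPro hpℓ, fun S hS => ?_⟩
  obtain ⟨-, ⟨-, -, hSi⟩, hSU⟩ := hS
  have hpow : ∀ n (x : S), ∃ k, (x : G) ^ ℓ ^ k ∈ K n := by
    intro n x
    have := h.normal n
    have hN : ((K n).subgroupOf S).Normal := inferInstance
    obtain ⟨k, hk⟩ := hSi _ hN ((h.isOpen n).preimage continuous_subtype_val)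
    refine ⟨k, ?_⟩
    have := ((K n).subgroupOf S).pow_index_mem x
    rw [hk] at this
    exact this
  let f : S →* Q := π.comp S.subtype
  have hf : Function.Injective f := by
    rw [injective_iff_map_eq_one]
    intro x hx
    refine Subtype.ext (h.eq_one _ fun n => ?_)
    obtain ⟨k, hk⟩ := hpow n x
    exact h.mem_of_pow_mem hpℓ hx hk
  have hSp : IsPGroup ℓ S := by
    intro x
    obtain ⟨k, hk⟩ := hpow 0 x
    refine ⟨k, hf ?_⟩
    rw [map_one, map_pow]
    rw [h.zero, MonoidHom.mem_ker, map_pow] at hk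
    exact hk
  have : Finite S := Finite.of_injective f hf
  have hidx : ¬ ℓ ∣ f.range.index := by
    have h1 : f.range = S.map π := by rw [MonoidHom.range_comp, Subgroup.range_subtype]
    rw [h1, ← Subgroup.index_comap_of_surjective _ h.surjective]
    refine hSU _ ?_ (Subgroup.le_comap_map _ _)
    refine Subgroup.isOpen_mono (H₁ := K 0) ?_ (h.isOpen 0)
    rw [h.zero]
    exact Subgroup.ker_le_comap π _
  refine rank_eq_of_discrete (ℓ := ℓ) (fun H => ?_) ?_
  · exact (hu (H.map f) ((hSp.to_subgroup H).map f)).of_mulEquiv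
      (Subgroup.equivMapOfInjective H f hf).symm
  · obtain ⟨A, _, φ, hφ, hA, hAq⟩ := hl
    obtain ⟨H, ⟨e⟩⟩ := exists_subgroup_mulEquiv f hf hidx φ.range (isPGroup_range hA φ)
    exact ⟨H, (hAq.of_mulEquiv (MonoidHom.ofInjective hφ)).of_mulEquiv e.symm⟩

end PFiltration

/-! ### The congruence filtration of `GL_d(ℤ_p)` -/

/-- The congruence subgroup of the invertible matrices that are the identity modulo `a`. -/
noncomputable def congruenceSubgroup {R : Type*} [CommRing R] (d : ℕ) (a : R) :
    Subgroup (Matrix.GeneralLinearGroup (Fin d) R) :=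
  (Matrix.GeneralLinearGroup.map (n := Fin d) (Ideal.Quotient.mk (Ideal.span {a}))).ker

section Congruence

variable {R : Type*} [CommRing R] {d : ℕ}

theorem mem_congruenceSubgroup_iff {a : R} {g : Matrix.GeneralLinearGroup (Fin d) R} :
    g ∈ congruenceSubgroup d a ↔
      ∀ i j, a ∣ (g : Matrix (Fin d) (Fin d) R) i j - (1 : Matrix (Fin d) (Fin d) R) i j := by
  have h : ∀ i j, Ideal.Quotient.mk (Ideal.span {a}) ((1 : Matrix (Fin d) (Fin d) R) i j) =
      (1 : Matrix (Fin d) (Fin d) (R ⧸ Ideal.span {a})) i j := fun i j => by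
    simp only [Matrix.one_apply]
    split_ifs <;> simp
  rw [congruenceSubgroup, MonoidHom.mem_ker, Units.ext_iff, ← Matrix.ext_iff]
  refine forall₂_congr fun i j => ?_
  rw [← Ideal.mem_span_singleton, ← Ideal.Quotient.eq, h]
  rfl

theorem mem_congruenceSubgroup_iff_exists {a : R} {g : Matrix.GeneralLinearGroup (Fin d) R} :
    g ∈ congruenceSubgroup d a ↔
      ∃ M : Matrix (Fin d) (Fin d) R, (g : Matrix (Fin d) (Fin d) R) - 1 = a • M := by
  rw [mem_congruenceSubgroup_iff]
  constructor
  · intro h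
    choose M hM using h
    exact ⟨Matrix.of M, Matrix.ext hM⟩
  · rintro ⟨M, hM⟩ i j
    exact ⟨M i j, congrFun (congrFun hM i) j⟩

/-- If `g ≡ 1` modulo `a p ^ n`, then `g ^ p - 1 = (1 + g + ⋯ + g ^ (p - 1)) (g - 1)`, where the
first factor is `≡ p` modulo `p`. -/
theorem pow_mem_congruenceSubgroup (p n : ℕ) {g : Matrix.GeneralLinearGroup (Fin d) R}
    (hg : g ∈ congruenceSubgroup d ((p : R) ^ (n + 1))) :
    g ^ p ∈ congruenceSubgroup d ((p : R) ^ (n + 2)) := by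
  rw [mem_congruenceSubgroup_iff_exists] at hg ⊢
  obtain ⟨M, hM⟩ := hg
  have hpow : ∀ i : ℕ, ∃ N : Matrix (Fin d) (Fin d) R,
      (g : Matrix (Fin d) (Fin d) R) ^ i = 1 + (p : R) • N := by
    intro i
    have hgM : (g : Matrix (Fin d) (Fin d) R) = 1 + (p : R) • ((p : R) ^ n • M) := by
      rw [smul_smul, ← pow_succ', ← hM]
      abel
    induction i with
    | zero => exact ⟨0, by simp⟩
    | succ i ih =>
      obtain ⟨N, hN⟩ := ih
      refine ⟨N * g + (p : R) ^ n • M, ?_⟩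
      rw [pow_succ, hN, add_mul, one_mul, smul_add, smul_mul_assoc]
      nth_rewrite 1 [hgM]
      abel
  choose N hN using hpow
  refine ⟨(1 + ∑ i ∈ Finset.range p, N i) * M, ?_⟩
  rw [Units.val_pow_eq_pow_val, ← geom_sum_mul, hM, Finset.sum_congr rfl fun i _ => hN i,
    Finset.sum_add_distrib, ← Finset.smul_sum, Finset.sum_const, Finset.card_range,
    ← Nat.cast_smul_eq_nsmul R, ← smul_add, smul_mul_smul_comm, ← pow_succ']

end Congruence

section Padic

variable {p : ℕ} [Fact p.Prime]

theorem isOpen_congruenceSubgroup (d n : ℕ) :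
    IsOpen (congruenceSubgroup d ((p : ℤ_[p]) ^ n) :
      Set (Matrix.GeneralLinearGroup (Fin d) ℤ_[p])) := by
  have hp : p.Prime := Fact.out
  have hopen : IsOpen {x : ℤ_[p] | (p : ℤ_[p]) ^ n ∣ x} := by
    have : {x : ℤ_[p] | (p : ℤ_[p]) ^ n ∣ x} = Metric.closedBall 0 ((p : ℝ) ^ (-n : ℤ)) := by
      ext x
      rw [mem_closedBall_zero_iff, PadicInt.norm_le_pow_iff_mem_span_pow,
        Ideal.mem_span_singleton]
      rfl
    rw [this]
    refine IsUltrametricDist.isOpen_closedBall 0 ?_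
    have : (0 : ℝ) < p := by exact_mod_cast hp.pos
    positivity
  have : (congruenceSubgroup d ((p : ℤ_[p]) ^ n) :
      Set (Matrix.GeneralLinearGroup (Fin d) ℤ_[p])) =
      ⋂ i, ⋂ j, (fun g : Matrix.GeneralLinearGroup (Fin d) ℤ_[p] =>
        (g : Matrix (Fin d) (Fin d) ℤ_[p]) i j - (1 : Matrix (Fin d) (Fin d) ℤ_[p]) i j) ⁻¹'
          {x : ℤ_[p] | (p : ℤ_[p]) ^ n ∣ x} := by
    ext g
    simp only [SetLike.mem_coe, mem_congruenceSubgroup_iff, Set.mem_iInter]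
    rfl
  rw [this]
  refine isOpen_iInter_of_finite fun i => isOpen_iInter_of_finite fun j => hopen.preimage ?_
  exact ((Units.continuous_val.matrix_elem i j)).sub continuous_const

theorem map_toZMod_surjective (d : ℕ) : Function.Surjective
    (Matrix.GeneralLinearGroup.map (n := Fin d) (PadicInt.toZMod (p := p))) := by
  intro g
  have hs : Function.Surjective (PadicInt.toZMod (p := p)) := ZMod.ringHom_surjective _
  choose s hs using hs
  let M : Matrix (Fin d) (Fin d) ℤ_[p] := Matrix.of fun i j => s (g i j)
  have hM : (PadicInt.toZMod (p := p)).mapMatrix M = g := by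
    ext i j
    exact hs _
  have hdet : IsUnit M.det := by
    refine isUnit_of_map_unit (PadicInt.toZMod (p := p)) _ ?_
    rw [RingHom.map_det, hM]
    exact (Matrix.isUnit_iff_isUnit_det _).mp g.isUnit
  exact ⟨Matrix.GeneralLinearGroup.mk'' M hdet, Units.ext hM⟩

theorem ker_map_toZMod (d : ℕ) :
    (Matrix.GeneralLinearGroup.map (n := Fin d) (PadicInt.toZMod (p := p))).ker =
      congruenceSubgroup d (p : ℤ_[p]) := by
  ext g
  rw [mem_congruenceSubgroup_iff, MonoidHom.mem_ker, Units.ext_iff, ← Matrix.ext_iff]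
  refine forall₂_congr fun i j => ?_
  have h : PadicInt.toZMod (p := p) ((1 : Matrix (Fin d) (Fin d) ℤ_[p]) i j) =
      (1 : Matrix (Fin d) (Fin d) (ZMod p)) i j := by
    simp only [Matrix.one_apply]
    split_ifs <;> simp
  rw [← Ideal.mem_span_singleton, ← PadicInt.maximalIdeal_eq_span_p, ← PadicInt.ker_toZMod,
    RingHom.mem_ker, map_sub, sub_eq_zero, h]
  rfl

theorem pFiltration_GL_padicInt (d : ℕ) :
    PFiltration p (Matrix.GeneralLinearGroup.map (n := Fin d) (PadicInt.toZMod (p := p)))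
      fun n => congruenceSubgroup d ((p : ℤ_[p]) ^ (n + 1)) where
  surjective := map_toZMod_surjective d
  normal n := MonoidHom.normal_ker _
  isOpen n := isOpen_congruenceSubgroup d (n + 1)
  zero := by rw [ker_map_toZMod, zero_add, pow_one]
  antitone a b hab g hg := by
    rw [mem_congruenceSubgroup_iff] at hg ⊢
    exact fun i j => (pow_dvd_pow _ (by omega)).trans (hg i j)
  eq_one g hg := by
    refine Units.ext (Matrix.ext fun i j => ?_)
    rw [← sub_eq_zero]
    by_contra hne
    -- a nonzero `p`-adic integer is not divisible by all powers of `p`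
    have h := FiniteMultiplicity.of_not_isUnit (PadicInt.prime_p (p := p)).not_isUnit hne
    exact h.not_pow_dvd_of_multiplicity_lt (Nat.lt_succ_self _)
      (mem_congruenceSubgroup_iff.mp (hg _) i j)
  pow_mem g hg n := by
    rw [ker_map_toZMod] at hg
    induction n with
    | zero => simpa using hg
    | succ n ih =>
      rw [pow_succ p n, pow_mul]
      exact pow_mem_congruenceSubgroup p n ih

theorem pFiltration_id {G : Type*} [Group G] [TopologicalSpace G] [DiscreteTopology G] (p : ℕ) :
    PFiltration p (MonoidHom.id G) fun _ => ⊥ where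
  surjective := Function.surjective_id
  normal _ := inferInstance
  isOpen _ := isOpen_discrete _
  zero := by ext; simp
  antitone := antitone_const
  eq_one x hx := by simpa using hx 0
  pow_mem x hx n := by simp_all

theorem ellRankEq_GL {ℓ : ℕ} [Fact ℓ.Prime] (hℓp : ℓ ≠ p) {d r : ℕ}
    (hu : ∀ H : Subgroup (Matrix.GeneralLinearGroup (Fin d) (ZMod p)), IsPGroup ℓ H → GenLE r H)
    (hl : ∃ (A : Type) (_ : Group A) (φ : A →* Matrix.GeneralLinearGroup (Fin d) (ZMod p)),
      Function.Injective φ ∧ IsPGroup ℓ A ∧ HasElementaryQuotient ℓ r A) :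
    EllRankEq ℓ (Matrix.GeneralLinearGroup (Fin d) ℤ_[p]) r ∧
      EllRankEq ℓ (Matrix.GeneralLinearGroup (Fin d) (ZMod p)) r := by
  have hpℓ : Nat.Coprime p ℓ := (Nat.coprime_primes Fact.out Fact.out).mpr hℓp.symm
  have : DiscreteTopology (Matrix.GeneralLinearGroup (Fin d) (ZMod p)) := inferInstance
  have : CompactSpace (Matrix (Fin d) (Fin d) ℤ_[p]) :=
    inferInstanceAs (CompactSpace (Fin d → Fin d → ℤ_[p]))
  exact ⟨(pFiltration_GL_padicInt d).ellRankEq hpℓ hu hl, (pFiltration_id p).ellRankEq hpℓ hu hl⟩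

end Padic

end PadicLieRank

theorem mainTheorem3 (p : ℕ) [Fact p.Prime] (hp : Odd p) (ℓ : ℕ) (hℓ : ℓ.Prime) (hℓp : ℓ ≠ p)
    (d : ℕ) (hd : 1 ≤ d) (d₀ : ℕ) (hd₀ : d₀ = 0 ∨ d₀ = 1) (hdd₀ : d ≡ d₀ [MOD 2]) :
    ∃ r : ℕ,
      PadicLieRank.EllRankEq ℓ (Matrix.GeneralLinearGroup (Fin d) ℤ_[p]) (r : ℕ∞) ∧
      PadicLieRank.EllRankEq ℓ (Matrix.GeneralLinearGroup (Fin d) (ZMod p)) (r : ℕ∞) ∧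
      r = if ¬ p ≡ 1 [MOD ℓ] then d / PadicLieRank.m p ℓ
          else if ℓ = 2 ∧ p ≡ 1 [MOD 4] then (3 * d - d₀) / 2
          else d := by
  open PadicLieRank in
  have : Fact ℓ.Prime := ⟨hℓ⟩
  have hm : m p ℓ = orderOf (p : ZMod ℓ) := m_eq_orderOf hℓp
  have hm0 : m p ℓ ≠ 0 := hm ▸ (orderOf_natCast_pos hℓp).ne'
  have hmd : ℓ ∣ p ^ m p ℓ - 1 := (dvd_pow_sub_one_iff _).mpr hm.symm.dvd
  have hm1 : p ≡ 1 [MOD ℓ] → m p ℓ = 1 := fun h => by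
    rw [hm, orderOf_eq_one_iff]
    exact_mod_cast (ZMod.natCast_eq_natCast_iff p 1 ℓ).mpr h
  have key : ∀ {r s : ℕ}, (∀ H : Subgroup (Matrix.GeneralLinearGroup (Fin d) (ZMod p)),
      IsPGroup ℓ H → GenLE r H) →
      (∃ (A : Type) (_ : Group A) (φ : A →* Matrix.GeneralLinearGroup (Fin d) (ZMod p)),
        Function.Injective φ ∧ IsPGroup ℓ A ∧ HasElementaryQuotient ℓ r A) → r = s →
      ∃ r : ℕ, EllRankEq ℓ (Matrix.GeneralLinearGroup (Fin d) ℤ_[p]) (r : ℕ∞) ∧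
        EllRankEq ℓ (Matrix.GeneralLinearGroup (Fin d) (ZMod p)) (r : ℕ∞) ∧ r = s :=
    fun {r s} hu hl hrs => ⟨r, (ellRankEq_GL hℓp hu hl).1, (ellRankEq_GL hℓp hu hl).2, hrs⟩
  rcases hℓ.eq_two_or_odd' with rfl | hodd
  · have hp2 : p % 2 = 1 := Nat.odd_iff.mp hp
    have h1 : p ≡ 1 [MOD 2] := hp2
    rw [if_neg (not_not.mpr h1)]
    by_cases h4 : p % 4 = 1
    · rw [if_pos ⟨rfl, h4⟩]
      have hd2 : d % 2 = d₀ % 2 := hdd₀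
      have hr : 3 * (d / 2) + d % 2 = d / 2 + d := by omega
      exact key (fun H hH => genLE_GL_two_of_one_mod_four h4 d H hH)
        (hr ▸ exists_pauli_hom_GL h4 d) (by omega)
    · rw [if_neg fun h => h4 h.2]
      have hl := exists_elementary_hom_GL hm0 hmd d
      rw [hm1 h1, Nat.div_one] at hl
      exact key (fun H hH => genLE_GL_two_of_three_mod_four (by omega) d H hH) hl rfl
  · refine key (fun H hH => genLE_GL_of_odd hℓp hodd d H hH)
      (exists_elementary_hom_GL hm0 hmd d) ?_
    split_ifs with h1 h2
    · obtain ⟨a, ha⟩ := hodd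
      omega
    · rw [hm1 h1, Nat.div_one]
    · rfl
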